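/- **Setting.** Let $\mathbf L=\{L_1,\dots,L_k\}$ (latent) and $\mathbf X=\{X_1,\dots,X_m\}$ (observed) be finitely many discrete random variables, each with at least two states and with $\mathbb P(V=v)>0$ for every variable $V\in\mathbf V=\mathbf L\cup\mathbf X$ and every state $v$ of $V$, and let $\mathcal G$ be a directed acyclic graph on $\mathbf V$. Assume that the model is a discrete latent structure model (LSM) in which all latent variables have the same number $r$ of states: 1. there are no edges between observed variables, and every observed variable is a pure child of some latent variable $L$, i.e. the edge $L\to X$ is the only edge of $\mathcal G$ at $X$; 2. every latent variable has at least three pure children; 3. every observed variable has more than $r$ states. No condition is imposed on the edges among the latent variables. Assume further: * (Markov) given its parents in $\mathcal G$, every $V\in\mathbf V$ is independent of its non-descendants; * (Faithfulness) every conditional independence relation (between disjoint sets of variables) that is true in $\mathbb P_{\mathbf V}$ is entailed by the Markov assumption applied to $\mathcal G$, i.e. holds for every discrete law that is Markov with respect to $\mathcal G$; * (Full rank) for every observed variable $X$ the columns of the table of $\mathbb P(X\mid \mathrm{Pa}_X)$ are linearly independent. For distinct observed variables let $\mathcal T_{(X_{i_1},\dots,X_{i_n})}$ be the $n$-way tensor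 of their joint probability mass function, and let $\mathrm{Rank}$ be the real tensor rank (least number of outer products of real vectors that sum to the tensor). **Algorithm 1.** Input: the joint law of $\mathbf X$ and the number $r$. Start with $\mathcal C=\emptyset$. For each triple of distinct observed variables $X_i,X_j,X_k$: if $\mathrm{Rank}(\mathcal T_{(X_i,X_j,X_k)})\ne r$, go to the next triple; otherwise, if $\mathrm{Rank}(\mathcal T_{(X_i,X_j,X_k,X_s)})=r$ for all $X_s\in\mathbf X\setminus\{X_i,X_j,X_k\}$, add $\{X_i,X_j,X_k\}$ to $\mathcal C$. Repeat this loop until no new set is found. Then replace two different overlapping sets of $\mathcal C$ by their union as long as there are such sets. Finally introduce one latent variable for each set $C\in\mathcal C$, with an edge to each $X_j\in C$, and return this graph and $\mathcal C$. **Theorem 2 (Identification of the measurement model).** Under these assumptions Algorithm 1 identifies the measurement model (the graph of the edges from latent to observed variables) completely: the algorithm terminates, and its result does not depend on the order of the merges; the family $\mathcal C$ that it returns consists exactly of the sets of observed children of $L_1,\dots,L_k$; and there is a bijection from the introduced latent variables to $L_1,\dots,L_k$ which, together with the identity on $\mathbf X$, carries the returned graph onto the measurement model of $\mathcal G$. 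-/

import Mathlib

namespace DiscreteLSM

open scoped Classical in
/-- The probability of the event `E` under the mass function `P`. -/
noncomputable def pr {Ω : Type} [Fintype Ω] (P : Ω → ℝ) (E : Ω → Prop) : ℝ :=
  ∑ x with E x, P x

/-! ### Discrete laws, directed graphs, Markov property and faithfulness -/

/-- Joint values of a family of discrete variables; the variable `v` has `n v` states. -/
abbrev Config {V : Type} (n : V → ℕ) : Type := (v : V) → Fin (n v)

/-- The probability that the variables in `S` take the values prescribed by `x`. -/
noncomputable def marg {V : Type} [Fintype V] [DecidableEq V] {n : V → ℕ}
    (P : Config n → ℝ) (S : Finset V) (x : Config n) : ℝ :=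
  pr P (fun y => ∀ v ∈ S, y v = x v)

/-- Conditional independence of the variables in `A` and those in `B` given those in `C`,
`P(a, b, c) P(c) = P(a, c) P(b, c)` for all values. -/
def CondIndep {V : Type} [Fintype V] [DecidableEq V] {n : V → ℕ}
    (P : Config n → ℝ) (A B C : Finset V) : Prop :=
  ∀ x : Config n, marg P (A ∪ B ∪ C) x * marg P C x = marg P (A ∪ C) x * marg P (B ∪ C) x

/-- There is no directed cycle. -/
def Acyclic {V : Type} (G : Digraph V) : Prop := ∀ v, ¬ Relation.TransGen G.Adj v v

open scoped Classical in
/-- The parents of `v`. -/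
noncomputable def parents {V : Type} [Fintype V] (G : Digraph V) (v : V) : Finset V :=
  {w | G.Adj w v}

open scoped Classical in
/-- The vertices other than `v` that cannot be reached from `v` by a directed path. -/
noncomputable def nonDescendants {V : Type} [Fintype V] (G : Digraph V) (v : V) : Finset V :=
  {w | ¬ Relation.ReflTransGen G.Adj v w}

/-- Causal Markov assumption: given its parents, each variable is independent of its
non-descendants. -/
def CausalMarkov {V : Type} [Fintype V] [DecidableEq V] (G : Digraph V) {n : V → ℕ}
    (P : Config n → ℝ) : Prop :=
  ∀ v, CondIndep P {v} (nonDescendants G v \ parents G v) (parents G v)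

/-- The conditional independence of `A` and `B` given `C` is entailed by the causal Markov
assumption applied to `G`: it holds for every discrete law that is Markov with respect to `G`. -/
def MarkovEntails {V : Type} [Fintype V] [DecidableEq V] (G : Digraph V)
    (A B C : Finset V) : Prop :=
  ∀ (n : V → ℕ) (Q : Config n → ℝ), Q ∈ stdSimplex ℝ (Config n) → CausalMarkov G Q →
    CondIndep Q A B C

/-- Faithfulness: every conditional independence (between disjoint sets of variables) true in `P`
is entailed by the causal Markov assumption applied to `G`. -/
def Faithful {V : Type} [Fintype V] [DecidableEq V] (G : Digraph V) {n : V → ℕ}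
    (P : Config n → ℝ) : Prop :=
  ∀ A B C : Finset V, Disjoint A B → Disjoint A C → Disjoint B C →
    CondIndep P A B C → MarkovEntails G A B C

/-- The event that the parents of `v` take the values `c`. -/
def ParentsAre {V : Type} (G : Digraph V) {n : V → ℕ} (v : V)
    (c : (w : {w // G.Adj w v}) → Fin (n w)) (x : Config n) : Prop :=
  ∀ w : {w // G.Adj w v}, x w = c w

/-- The table of `P(v | parents of v)` has linearly independent columns. There is one column for
each joint value of the parents that has positive probability. -/
def FullColumnRank {V : Type} [Fintype V] [DecidableEq V] (G : Digraph V) {n : V → ℕ}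
    (P : Config n → ℝ) (v : V) : Prop :=
  LinearIndependent ℝ
    (fun (c : {c : (w : {w // G.Adj w v}) → Fin (n w) // 0 < pr P (ParentsAre G v c)})
      (a : Fin (n v)) =>
        pr P (fun x => x v = a ∧ ParentsAre G v c.1 x) / pr P (ParentsAre G v c.1))

/-! ### Discrete causal models with latent variables -/

/-- A discrete causal model with latent variables `L₁, …, L_k` (the vertices `Sum.inl l`) and
observed variables `X₁, …, X_m` (the vertices `Sum.inr i`). -/
structure Model (k m : ℕ) where
  /-- number of states of each variable -/
  card : Fin k ⊕ Fin m → ℕ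
  two_le_card : ∀ v, 2 ≤ card v
  /-- the causal graph -/
  graph : Digraph (Fin k ⊕ Fin m)
  acyclic : Acyclic graph
  /-- the joint law -/
  prob : Config card → ℝ
  prob_mem : prob ∈ stdSimplex ℝ (Config card)
  /-- all states of every variable have positive probability -/
  marginal_pos : ∀ (v : Fin k ⊕ Fin m) (a : Fin (card v)), 0 < pr prob (fun x => x v = a)

/-- `i` is a pure child of the latent variable `l`: the edge `l → i` is the only edge at `i`. -/
def Model.IsPureChild {k m : ℕ} (M : Model k m) (l : Fin k) (i : Fin m) : Prop :=
  M.graph.Adj (Sum.inl l) (Sum.inr i) ∧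
    (∀ v, M.graph.Adj v (Sum.inr i) → v = Sum.inl l) ∧ ∀ v, ¬ M.graph.Adj (Sum.inr i) v

open scoped Classical in
/-- The observed children of a latent variable. -/
noncomputable def Model.children {k m : ℕ} (M : Model k m) (l : Fin k) : Finset (Fin m) :=
  {i | M.graph.Adj (Sum.inl l) (Sum.inr i)}

/-- Discrete latent structure model. -/
structure Model.IsLSM {k m : ℕ} (M : Model k m) : Prop where
  /-- there are no edges between observed variables -/
  no_edge : ∀ i j : Fin m, ¬ M.graph.Adj (Sum.inr i) (Sum.inr j)
  /-- the observed variables are pure measurements of the latent ones -/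
  pure : ∀ i : Fin m, ∃ l, M.IsPureChild l i
  /-- each latent variable has at least three pure children -/
  three_children : ∀ l : Fin k, ∃ S : Finset (Fin m), 3 ≤ S.card ∧ ∀ i ∈ S, M.IsPureChild l i
  /-- observed variables have more states than latent ones -/
  card_lt : ∀ (l : Fin k) (i : Fin m), M.card (Sum.inl l) < M.card (Sum.inr i)

/-- The joint law of the observed variables. -/
noncomputable def Model.obsLaw {k m : ℕ} (M : Model k m) :
    Config (fun i : Fin m => M.card (Sum.inr i)) → ℝ :=
  fun x => pr M.prob (fun y => ∀ i, y (Sum.inr i) = x i)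

/-- The measurement model: the edges from latent to observed variables. -/
def Model.measurementModel {k m : ℕ} (M : Model k m) : Digraph (Fin k ⊕ Fin m) where
  Adj u v := M.graph.Adj u v ∧ u.isLeft ∧ v.isRight

/-! ### Tensor rank -/

/-- The least number of outer products of vectors that sum to the `N`-way tensor `T`. -/
noncomputable def tensorRank {N : ℕ} {I : Fin N → ℕ} (T : ((t : Fin N) → Fin (I t)) → ℝ) : ℕ :=
  sInf {R | ∃ u : Fin R → (t : Fin N) → Fin (I t) → ℝ, ∀ a, T a = ∑ j, ∏ t, u j t (a t)}

/-- The probability tensor of the observed variables `X_{ι 0}, …, X_{ι (N-1)}`. -/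
noncomputable def tensor {m N : ℕ} {d : Fin m → ℕ} (p : Config d → ℝ) (ι : Fin N → Fin m) :
    ((t : Fin N) → Fin (d (ι t))) → ℝ :=
  fun a => pr p (fun x => ∀ t, x (ι t) = a t)

/-! ### The algorithm. Its input is the law `p` of the observed variables and the number `r`. -/

/-- All triples of distinct observed variables, in the order of three nested loops. -/
def triples (m : ℕ) : List (Fin m × Fin m × Fin m) :=
  ((List.finRange m).product ((List.finRange m).product (List.finRange m))).filter
    (fun t => t.1 ≠ t.2.1 ∧ t.1 ≠ t.2.2 ∧ t.2.1 ≠ t.2.2)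

open scoped Classical in
/-- The body of the `for` loop, for one triple: skip it if the rank of its 3-way tensor is not `r`;
otherwise record it if the ranks of all the 4-way tensors that extend it are `r`. -/
noncomputable def testTriple {m : ℕ} {d : Fin m → ℕ} (p : Config d → ℝ) (r : ℕ)
    (𝒞 : Finset (Finset (Fin m))) : Fin m × Fin m × Fin m → Finset (Finset (Fin m))
  | (i, j, k) =>
    if tensorRank (tensor p ![i, j, k]) ≠ r then 𝒞
    else if ∀ s, s ∉ ({i, j, k} : Finset (Fin m)) → tensorRank (tensor p ![i, j, k, s]) = r then
      insert {i, j, k} 𝒞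
    else 𝒞

/-- One complete `for` loop over all triples. -/
noncomputable def pass {m : ℕ} {d : Fin m → ℕ} (p : Config d → ℝ) (r : ℕ)
    (𝒞 : Finset (Finset (Fin m))) : Finset (Finset (Fin m)) :=
  (triples m).foldl (testTriple p r) 𝒞

theorem subset_pass {m : ℕ} {d : Fin m → ℕ} (p : Config d → ℝ) (r : ℕ)
    (𝒞 : Finset (Finset (Fin m))) : 𝒞 ⊆ pass p r 𝒞 := by
  unfold pass
  induction triples m generalizing 𝒞 with
  | nil => exact Finset.Subset.refl _
  | cons t ts ih =>
    refine Finset.Subset.trans ?_ (ih _)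
    obtain ⟨i, j, k⟩ := t
    simp only [testTriple]
    split_ifs
    · exact Finset.Subset.refl _
    · exact Finset.subset_insert _ _
    · exact Finset.Subset.refl _

/-- Repeat the `for` loop until it finds no new cluster. -/
noncomputable def search {m : ℕ} {d : Fin m → ℕ} (p : Config d → ℝ) (r : ℕ)
    (𝒞 : Finset (Finset (Fin m))) : Finset (Finset (Fin m)) :=
  if pass p r 𝒞 = 𝒞 then 𝒞 else search p r (pass p r 𝒞)
termination_by 𝒞ᶜ.card
decreasing_by
  rename_i h
  apply Finset.card_lt_card
  rw [Finset.compl_ssubset_compl]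
  exact (subset_pass p r 𝒞).ssubset_of_ne (Ne.symm h)

/-- One merge: two different overlapping sets of the family are replaced by their union. -/
def MergeStep {m : ℕ} (𝒞 𝒟 : Finset (Finset (Fin m))) : Prop :=
  ∃ A ∈ 𝒞, ∃ B ∈ 𝒞, A ≠ B ∧ (A ∩ B).Nonempty ∧ 𝒟 = insert (A ∪ B) ((𝒞.erase A).erase B)

/-- `𝒞` is the family of clusters returned by some run of the algorithm: search for triples, then
merge overlapping sets, in any order, until no two sets overlap. -/
def Outputs {m : ℕ} {d : Fin m → ℕ} (p : Config d → ℝ) (r : ℕ)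
    (𝒞 : Finset (Finset (Fin m))) : Prop :=
  Relation.ReflTransGen MergeStep (search p r ∅) 𝒞 ∧ ∀ 𝒟, ¬ MergeStep 𝒞 𝒟

/-- The graph returned with `𝒞`: one new latent variable for each cluster, with an edge to each
member of the cluster. -/
def outputGraph {m : ℕ} (𝒞 : Finset (Finset (Fin m))) : Digraph ({A // A ∈ 𝒞} ⊕ Fin m) where
  Adj
    | Sum.inl A, Sum.inr i => i ∈ A.1
    | _, _ => False

end DiscreteLSM

/-! The test accepts a triple of observed variables exactly when the three have the same latent
parent; merging the accepted triples then recovers the sets of children.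

Siblings pass. Given their parent L the children are independent of each other and of any further
variable, so summing over the r states of L writes the tensor as r outer products, even with one
arbitrary variable among the factors (`Model.hasRankLE_of_siblings`). Conversely, full column rank
gives functions of a child that detect the state of L. Applied to two children, they turn an R-term
decomposition into a factorization of the invertible diagonal matrix of the probabilities P(L = c)
through dimension R, so r ≤ R (`Model.le_of_hasRankLE`).

Other triples fail. Suppose a 4-way tensor of rank r contains two children of L. The same detecting
functions give square r × r factorizations of diagonal matrices, whose algebra
(`diagonal_mul_of_square`) forces the other two variables to be independent given L
(`Model.Splits.condIndep`). By faithfulness these two have no common ancestor with directed paths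
avoiding L: otherwise a coin tossed at that ancestor and copied along those paths is a Markov law
violating the independence (`not_markovEntails`). If exactly two members of the triple are siblings,
another child of the third member's parent, taken as fourth variable, gives a contradiction. If the
three parents are distinct, a second child of each parent in turn gives three separations; in an
acyclic graph these leave no common ancestors at all (`not_common_ancestor`), so the three variables
are independent and their 3-way tensor has rank at most 1 < r.

Merging. `Chains` is preserved by every merge, and a family with this property in which no two sets
overlap consists of the full sets of children. Hence the order of the merges is irrelevant. -/

namespace DiscreteLSM

/-! ### Finite acyclic graphs -/

section Digraph

variable {V : Type}

theorem parents_subset_nonDescendants [Fintype V] {G : Digraph V} (hG : Acyclic G) (v : V) :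
    parents G v ⊆ nonDescendants G v := by
  intro w hw
  simp only [parents, nonDescendants, Finset.mem_filter, Finset.mem_univ, true_and] at hw ⊢
  exact fun h => hG v (Relation.TransGen.tail' h hw)

theorem self_notMem_nonDescendants [Fintype V] (G : Digraph V) (v : V) : v ∉ nonDescendants G v := by
  simp only [nonDescendants, Finset.mem_filter, Finset.mem_univ, true_and, not_not]
  exact Relation.ReflTransGen.refl

/-- Reversed reachability is well-founded on a finite acyclic graph. The sink is the vertex to be
averaged out first in an induction over ancestral sets. -/
theorem exists_sink [Fintype V] {G : Digraph V} (hG : Acyclic G) {A : Finset V} (hA : A.Nonempty) :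
    ∃ v ∈ A, ∀ w ∈ A, w ≠ v → ¬ Relation.ReflTransGen G.Adj v w := by
  have : IsTrans V (fun a b => Relation.TransGen G.Adj b a) := ⟨fun _ _ _ h1 h2 => h2.trans h1⟩
  have : Std.Irrefl (fun a b => Relation.TransGen G.Adj b a) := ⟨hG⟩
  obtain ⟨v, hv, hmin⟩ := (Finite.wellFounded_of_trans_of_irrefl
    (fun a b => Relation.TransGen G.Adj b a)).has_min (A : Set V) hA
  refine ⟨v, hv, fun w hw hne h => hmin w hw ?_⟩
  rcases Relation.reflTransGen_iff_eq_or_transGen.1 h with h | h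
  · exact absurd h hne
  · exact h

theorem mem_of_reach {G : Digraph V} {B : Finset V} (hB : ∀ u w, G.Adj u w → w ∈ B → u ∈ B)
    {v w : V} (h : Relation.ReflTransGen G.Adj v w) (hw : w ∈ B) : v ∈ B := by
  induction h using Relation.ReflTransGen.head_induction_on with
  | refl => exact hw
  | head h' _ ih => exact hB _ _ h' ih

end Digraph

/-! ### Integrating out variables under the Markov property -/

section Markov

variable {V : Type} [Fintype V] [DecidableEq V] {n : V → ℕ}

theorem pr_nonneg {Ω : Type} [Fintype Ω] {P : Ω → ℝ} (hP : ∀ x, 0 ≤ P x) (E : Ω → Prop) :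
    0 ≤ pr P E :=
  Finset.sum_nonneg fun x _ => hP x

theorem pr_mono {Ω : Type} [Fintype Ω] {P : Ω → ℝ} (hP : ∀ x, 0 ≤ P x) {E F : Ω → Prop}
    (h : ∀ x, E x → F x) : pr P E ≤ pr P F := by
  classical
  unfold pr
  refine Finset.sum_le_sum_of_subset_of_nonneg ?_ fun x _ _ => hP x
  intro x hx
  simp only [Finset.mem_filter, Finset.mem_univ, true_and] at hx ⊢
  exact h x hx

open scoped Classical in
theorem pr_eq_sum_ite {Ω : Type} [Fintype Ω] (P : Ω → ℝ) (E : Ω → Prop) :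
    pr P E = ∑ x, P x * (if E x then 1 else 0) := by
  unfold pr
  rw [Finset.sum_filter]
  refine Finset.sum_congr rfl fun x _ => ?_
  split_ifs <;> simp

theorem marg_congr (P : Config n → ℝ) {S : Finset V} {x y : Config n}
    (h : ∀ v ∈ S, x v = y v) : marg P S x = marg P S y := by
  unfold marg
  congr 1
  funext z
  exact propext (forall₂_congr fun v hv => by rw [h v hv])

/-- The conditional probability that `v` takes the value `b` given that its parents take
the values prescribed by `x`. -/
noncomputable def kernel (G : Digraph V) (P : Config n → ℝ) (v : V) (b : Fin (n v))
    (x : Config n) : ℝ :=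
  marg P (insert v (parents G v)) (Function.update x v b) / marg P (parents G v) x

theorem kernel_congr (G : Digraph V) (P : Config n → ℝ) (v : V) (b : Fin (n v)) {x y : Config n}
    (h : ∀ w ∈ parents G v, x w = y w) : kernel G P v b x = kernel G P v b y := by
  unfold kernel
  rw [marg_congr P h, marg_congr P (x := Function.update x v b) (y := Function.update y v b)]
  intro w hw
  by_cases hwv : w = v
  · subst hwv; simp
  · simp only [Function.update_of_ne hwv]
    exact h w ((Finset.mem_insert.1 hw).resolve_left hwv)

/-- The Markov property in product form: since the parents are among the non-descendants,
conditioning on all non-descendants amounts to conditioning on the parents. -/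
theorem marg_insert_nonDescendants {G : Digraph V} (hG : Acyclic G) {P : Config n → ℝ}
    (hP : ∀ x, 0 ≤ P x) (hM : CausalMarkov G P) (v : V) (b : Fin (n v)) (x : Config n) :
    marg P (insert v (nonDescendants G v)) (Function.update x v b) =
      kernel G P v b x * marg P (nonDescendants G v) x := by
  have hsub := parents_subset_nonDescendants hG v
  have hv := self_notMem_nonDescendants G v
  have hupd : ∀ S ⊆ nonDescendants G v, marg P S (Function.update x v b) = marg P S x := by
    intro S hS
    refine marg_congr P fun w hw => Function.update_of_ne ?_ _ _
    rintro rfl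
    exact hv (hS hw)
  have h := hM v (Function.update x v b)
  have e1 : {v} ∪ (nonDescendants G v \ parents G v) ∪ parents G v
      = insert v (nonDescendants G v) := by
    rw [Finset.union_assoc, Finset.sdiff_union_of_subset hsub, Finset.insert_eq]
  rw [e1, Finset.sdiff_union_of_subset hsub, ← Finset.insert_eq, hupd _ hsub,
    hupd _ (Finset.Subset.refl _)] at h
  unfold kernel
  by_cases h0 : marg P (parents G v) x = 0
  -- Parents of probability zero: the kernel is 0 by the convention for division, and the left side
  -- is bounded by the probability of that null event.
  · rw [h0, div_zero, zero_mul]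
    refine le_antisymm ?_ (pr_nonneg hP _)
    rw [← h0, ← hupd _ hsub]
    exact pr_mono hP fun y hy w hw => hy w (Finset.mem_insert_of_mem (hsub hw))
  · rw [div_mul_eq_mul_div, eq_div_iff h0, h]

/-- Given its parents, a variable may be averaged out against any function of its
non-descendants. -/
theorem sum_mul_eq_sum_kernel {G : Digraph V} (hG : Acyclic G) {P : Config n → ℝ}
    (hP : ∀ x, 0 ≤ P x) (hM : CausalMarkov G P) (v : V) (φ : Fin (n v) → ℝ) {g : Config n → ℝ}
    (hg : DependsOn g (nonDescendants G v : Set V)) :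
    ∑ y, P y * (φ (y v) * g y) = ∑ y, P y * ((∑ b, φ b * kernel G P v b y) * g y) := by
  classical
  have key : ∀ b : Fin (n v), ∑ y, P y * ((if y v = b then 1 else 0) * g y)
      = ∑ y, P y * (kernel G P v b y * g y) := by
    intro b
    -- On a fibre of the restriction to the non-descendants both `g` and the kernel are constant, so
    -- the claim reduces to `marg_insert_nonDescendants`.
    let ρ : Config n → ((w : nonDescendants G v) → Fin (n w)) := fun y w => y w
    rw [← Finset.sum_fiberwise Finset.univ ρ, ← Finset.sum_fiberwise Finset.univ ρ]
    refine Finset.sum_congr rfl fun z _ => ?_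
    by_cases hz : ∃ x, ρ x = z
    · obtain ⟨x, rfl⟩ := hz
      have hρ : ∀ y, ρ y = ρ x ↔ ∀ w ∈ nonDescendants G v, y w = x w := by
        intro y
        constructor
        · intro h w hw
          exact congrFun h ⟨w, hw⟩
        · intro h
          funext w
          exact h w w.2
      have hgx : ∀ y, ρ y = ρ x → g y = g x := fun y hy => hg ((hρ y).1 hy)
      have hkx : ∀ y, ρ y = ρ x → kernel G P v b y = kernel G P v b x := fun y hy =>
        kernel_congr G P v b fun w hw => (hρ y).1 hy w (parents_subset_nonDescendants hG v hw)
      have hm := marg_insert_nonDescendants hG hP hM v b x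
      have l1 : ∑ y with ρ y = ρ x, P y * ((if y v = b then 1 else 0) * g y)
          = marg P (insert v (nonDescendants G v)) (Function.update x v b) * g x := by
        unfold marg
        rw [pr_eq_sum_ite, Finset.sum_mul, Finset.sum_filter]
        refine Finset.sum_congr rfl fun y _ => ?_
        have : (∀ w ∈ insert v (nonDescendants G v), y w = Function.update x v b w) ↔
            (ρ y = ρ x ∧ y v = b) := by
          rw [hρ, Finset.forall_mem_insert, Function.update_self, and_comm]
          refine and_congr_left fun _ => forall₂_congr fun w hw => ?_
          rw [Function.update_of_ne]
          rintro rfl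
          exact self_notMem_nonDescendants G w hw
        simp only [this]
        by_cases h1 : ρ y = ρ x <;> by_cases h2 : y v = b <;> simp [h1, h2, hgx]
      have l2 : ∑ y with ρ y = ρ x, P y * (kernel G P v b y * g y)
          = kernel G P v b x * marg P (nonDescendants G v) x * g x := by
        unfold marg
        rw [pr_eq_sum_ite, Finset.mul_sum, Finset.sum_mul, Finset.sum_filter]
        refine Finset.sum_congr rfl fun y _ => ?_
        by_cases h1 : ρ y = ρ x
        · rw [if_pos h1, if_pos ((hρ y).1 h1), hgx y h1, hkx y h1]; ring
        · rw [if_neg h1, if_neg (fun h => h1 ((hρ y).2 h))]; ring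
      rw [l1, l2, hm]
    · have : Finset.univ.filter (fun y => ρ y = z) = ∅ :=
        Finset.filter_eq_empty_iff.2 fun y _ hy => hz ⟨y, hy⟩
      rw [this, Finset.sum_empty, Finset.sum_empty]
  have h1 : ∀ y, P y * (φ (y v) * g y)
      = ∑ b, φ b * (P y * ((if y v = b then 1 else 0) * g y)) := by
    intro y
    simp [mul_left_comm]
  have h2 : ∀ y, P y * ((∑ b, φ b * kernel G P v b y) * g y)
      = ∑ b, φ b * (P y * (kernel G P v b y * g y)) := by
    intro y
    rw [Finset.sum_mul, Finset.mul_sum]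
    exact Finset.sum_congr rfl fun b _ => by ring
  simp_rw [h1, h2]
  rw [Finset.sum_comm, Finset.sum_comm (s := Finset.univ (α := Config n))]
  refine Finset.sum_congr rfl fun b _ => ?_
  rw [← Finset.mul_sum, ← Finset.mul_sum, key b]

/-- Variables without common ancestors are independent. -/
theorem sum_mul_mul_of_ancestral {G : Digraph V} (hG : Acyclic G) {P : Config n → ℝ}
    (hP : ∀ x, 0 ≤ P x) (hP1 : ∑ x, P x = 1) (hM : CausalMarkov G P) {B : Finset V}
    (hB : ∀ u w, G.Adj u w → w ∈ B → u ∈ B) {g : Config n → ℝ} (hg : DependsOn g (B : Set V))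
    (A : Finset V) (hA : ∀ u w, G.Adj u w → w ∈ A → u ∈ A) (hAB : Disjoint A B)
    {f : Config n → ℝ} (hf : DependsOn f (A : Set V)) :
    ∑ y, P y * (f y * g y) = (∑ y, P y * f y) * ∑ y, P y * g y := by
  classical
  -- Averaging out a sink of `A` replaces `f` by functions of the smaller ancestral set `A.erase v`.
  induction hc : A.card generalizing A f with
  | zero =>
    obtain rfl := Finset.card_eq_zero.1 hc
    have hf' : ∀ x y, f x = f y := fun x y => hf (by simp)
    by_cases hne : Nonempty (Config n)
    · obtain ⟨x⟩ := hne
      simp_rw [fun y => hf' y x]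
      rw [← Finset.sum_mul, hP1, one_mul, Finset.mul_sum]
      exact Finset.sum_congr rfl fun y _ => by ring
    · have := not_nonempty_iff.1 hne
      simp
  | succ k ih =>
    obtain ⟨v, hvA, hv⟩ := exists_sink hG (Finset.card_pos.1 (by omega : 0 < A.card))
    have hBN : ∀ w ∈ B, w ∈ nonDescendants G v := by
      intro w hw
      simp only [nonDescendants, Finset.mem_filter, Finset.mem_univ, true_and]
      intro h
      exact Finset.disjoint_left.1 hAB hvA (mem_of_reach hB h hw)
    have hAN : ∀ w ∈ A.erase v, w ∈ nonDescendants G v := by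
      intro w hw
      simp only [nonDescendants, Finset.mem_filter, Finset.mem_univ, true_and]
      exact hv w (Finset.mem_of_mem_erase hw) (Finset.ne_of_mem_erase hw)
    have hA' : ∀ u w, G.Adj u w → w ∈ A.erase v → u ∈ A.erase v := by
      intro u w huw hw
      refine Finset.mem_erase.2 ⟨?_, hA u w huw (Finset.mem_of_mem_erase hw)⟩
      rintro rfl
      exact hv w (Finset.mem_of_mem_erase hw) (Finset.ne_of_mem_erase hw)
        (Relation.ReflTransGen.single huw)
    have hpa : ∀ w ∈ parents G v, w ∈ A.erase v := by
      intro w hw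
      have hw' : G.Adj w v := by simpa [parents] using hw
      refine Finset.mem_erase.2 ⟨?_, hA w v hw' hvA⟩
      rintro rfl
      exact hG w (Relation.TransGen.single hw')
    have hfb : ∀ b, DependsOn (fun y => f (Function.update y v b)) (A.erase v : Set V) := by
      intro b x y hxy
      refine hf fun w hw => ?_
      by_cases hwv : w = v
      · subst hwv; simp
      · simp only [Function.update_of_ne hwv]
        exact hxy w (by simpa [hwv] using hw)
    have hkb : ∀ b, DependsOn (kernel G P v b) (A.erase v : Set V) := fun b x y hxy =>
      kernel_congr G P v b fun w hw => hxy w (by exact_mod_cast hpa w hw)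
    have hsplit : ∀ y, f y = ∑ b, (if y v = b then 1 else 0) * f (Function.update y v b) := by
      intro y
      simp
    have step : ∀ h : Config n → ℝ, DependsOn h (B : Set V) →
        ∑ y, P y * (f y * h y)
          = ∑ b, ∑ y, P y * ((kernel G P v b y * f (Function.update y v b)) * h y) := by
      intro h hh
      have h1 : ∀ y, P y * (f y * h y) = ∑ b, P y * ((if y v = b then 1 else 0) *
          (f (Function.update y v b) * h y)) := by
        intro y
        conv_lhs => rw [hsplit y, Finset.sum_mul, Finset.mul_sum]
        exact Finset.sum_congr rfl fun b _ => by ring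
      simp_rw [h1]
      rw [Finset.sum_comm]
      refine Finset.sum_congr rfl fun b _ => ?_
      have hdep : DependsOn (fun y => f (Function.update y v b) * h y)
          (nonDescendants G v : Set V) := by
        intro x y hxy
        have e1 := hfb b (fun w hw => hxy w (by exact_mod_cast hAN w (by exact_mod_cast hw)))
        have e2 := hh (fun w hw => hxy w (by exact_mod_cast hBN w (by exact_mod_cast hw)))
        simp only at e1 ⊢
        rw [e1, e2]
      have := sum_mul_eq_sum_kernel hG hP hM v (fun c => if c = b then 1 else 0) hdep
      simp only [ite_mul, one_mul, zero_mul, Finset.sum_ite_eq', Finset.mem_univ, if_true] at this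
      simp only [ite_mul, one_mul, zero_mul]
      rw [this]
      exact Finset.sum_congr rfl fun y _ => by ring
    -- The same reduction with `g = 1` expands the mean of `f`, so the two sides can be compared
    -- term by term.
    have hone := step (fun _ => 1) (fun _ _ _ => rfl)
    simp only [mul_one] at hone
    rw [step g hg, hone, Finset.sum_mul]
    refine Finset.sum_congr rfl fun b _ => ?_
    refine ih (A.erase v) hA' (Finset.disjoint_of_subset_left (Finset.erase_subset _ _) hAB)
      (f := fun y => kernel G P v b y * f (Function.update y v b)) ?_
      (by rw [Finset.card_erase_of_mem hvA]; omega)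
    intro x y hxy
    have e1 := hfb b hxy
    simp only at e1 ⊢
    rw [e1, hkb b hxy]

end Markov

/-! ### Common ancestors and Markov laws that violate independence -/

section Faithfulness

variable {V : Type}

/-- There is a directed path from `u` to `v` that does not enter `w`. -/
abbrev ReachAvoiding (G : Digraph V) (w u v : V) : Prop :=
  Relation.ReflTransGen (fun a b => G.Adj a b ∧ b ≠ w) u v

theorem ReachAvoiding.reach {G : Digraph V} {w u v : V} (h : ReachAvoiding G w u v) :
    Relation.ReflTransGen G.Adj u v :=
  Relation.ReflTransGen.mono (fun _ _ h => h.1) _ _ h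

theorem ReachAvoiding.ne {G : Digraph V} {w u v : V} (h : ReachAvoiding G w u v) (hu : u ≠ w) :
    v ≠ w := by
  rcases Relation.ReflTransGen.cases_tail h with h | ⟨_, _, h⟩
  · rwa [h]
  · exact h.2

theorem reachAvoiding_or {G : Digraph V} (w : V) {u v : V}
    (h : Relation.ReflTransGen G.Adj u v) :
    ReachAvoiding G w u v ∨
      (Relation.ReflTransGen G.Adj u w ∧ Relation.ReflTransGen G.Adj w v) := by
  induction h with
  | refl => exact Or.inl .refl
  | @tail b c hab hbc ih =>
    rcases ih with ih | ih
    · by_cases hc : c = w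
      · subst hc
        exact Or.inr ⟨hab.tail hbc, .refl⟩
      · exact Or.inl (ih.tail ⟨hbc, hc⟩)
    · exact Or.inr ⟨ih.1, ih.2.tail hbc⟩

theorem eq_of_reach_of_reach {G : Digraph V} (hG : Acyclic G) {u v : V}
    (h1 : Relation.ReflTransGen G.Adj u v) (h2 : Relation.ReflTransGen G.Adj v u) : u = v := by
  rcases Relation.reflTransGen_iff_eq_or_transGen.1 h1 with h | h
  · exact h.symm
  · exact absurd (h.trans_left h2) (hG u)

/-- If no two of three vertices have a common ancestor whose paths avoid the third vertex, then
there are no directed paths between them. -/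
theorem not_reach_of_avoiding {G : Digraph V} (hG : Acyclic G) {a b c : V} (hcb : c ≠ b)
    (hb : ∀ z, z ≠ b → ReachAvoiding G b z a → ReachAvoiding G b z c → False)
    (hc : ∀ z, z ≠ c → ReachAvoiding G c z a → ReachAvoiding G c z b → False) :
    ¬ Relation.ReflTransGen G.Adj c a := by
  intro h
  rcases reachAvoiding_or b h with h1 | ⟨h1, h2⟩
  · exact hb c hcb h1 .refl
  · rcases reachAvoiding_or c h2 with h3 | ⟨h3, -⟩
    · exact hc b hcb.symm h3 .refl
    · exact hcb (eq_of_reach_of_reach hG h1 h3)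

/-- By `not_reach_of_avoiding`, `c` reaches neither `a` nor `b`. Paths from a common ancestor to `a`
and `b` therefore avoid `c`, which `hc` forbids. -/
theorem not_common_ancestor {G : Digraph V} (hG : Acyclic G) {a b c : V} (hcb : c ≠ b)
    (hca : c ≠ a)
    (ha : ∀ z, z ≠ a → ReachAvoiding G a z b → ReachAvoiding G a z c → False)
    (hb : ∀ z, z ≠ b → ReachAvoiding G b z a → ReachAvoiding G b z c → False)
    (hc : ∀ z, z ≠ c → ReachAvoiding G c z a → ReachAvoiding G c z b → False)
    (z : V) (hza : Relation.ReflTransGen G.Adj z a) (hzb : Relation.ReflTransGen G.Adj z b) :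
    False := by
  have h1 := not_reach_of_avoiding hG hcb hb hc
  have h2 := not_reach_of_avoiding hG hca ha (fun z hz h h' => hc z hz h' h)
  have hzc : z ≠ c := by
    rintro rfl
    exact h1 hza
  exact hc z hzc ((reachAvoiding_or c hza).resolve_right fun h => h1 h.2)
    ((reachAvoiding_or c hzb).resolve_right fun h => h2 h.2)

open scoped Classical in
/-- The configuration in which the vertices of `S` have the value `t` and all others `0`. -/
noncomputable def copyConfig (S : Set V) (t : Fin 2) : Config (fun _ : V => 2) :=
  fun v => if v ∈ S then t else 0

open scoped Classical in
/-- The law of a fair coin that all vertices of `S` copy. -/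
noncomputable def copyLaw (S : Set V) (y : Config (fun _ : V => 2)) : ℝ :=
  (if y = copyConfig S 0 then 1 / 2 else 0) + (if y = copyConfig S 1 then 1 / 2 else 0)

variable [Fintype V] [DecidableEq V]

open scoped Classical in
theorem pr_copyLaw (S : Set V) (E : Config (fun _ : V => 2) → Prop) :
    pr (copyLaw S) E = (if E (copyConfig S 0) then 1 / 2 else 0)
      + (if E (copyConfig S 1) then 1 / 2 else 0) := by
  unfold pr copyLaw
  rw [Finset.sum_add_distrib]
  simp [Finset.sum_ite_eq', Finset.mem_filter]

theorem copyLaw_mem (S : Set V) : copyLaw S ∈ stdSimplex ℝ (Config (fun _ : V => 2)) := by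
  classical
  constructor
  · intro y
    unfold copyLaw
    positivity
  · have := pr_copyLaw S (fun _ => True)
    simp only [pr, Finset.filter_true, if_true] at this
    rw [this]
    norm_num

/-- Given `C`, the vertex `v` is deterministic: if `C` meets `S` it reveals the coin, and otherwise
`v` lies outside `S` and is constantly 0. -/
theorem condIndep_copyLaw_of_determined (S : Set V) {v : V} {B C : Finset V}
    (h : (∀ w ∈ C, w ∉ S) → v ∉ S) : CondIndep (copyLaw S) {v} B C := by
  classical
  intro x
  simp only [marg, pr_copyLaw, Finset.mem_union, Finset.mem_singleton, or_imp, forall_and,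
    forall_eq]
  by_cases hC : ∀ w ∈ C, w ∉ S
  · have hd : ∀ w ∈ C, copyConfig S 0 w = copyConfig S 1 w := fun w hw => by
      simp [copyConfig, hC w hw]
    have hv : copyConfig S 0 v = copyConfig S 1 v := by simp [copyConfig, h hC]
    have hd' : (∀ w ∈ C, copyConfig S 0 w = x w) ↔ (∀ w ∈ C, copyConfig S 1 w = x w) :=
      forall₂_congr fun w hw => by rw [hd w hw]
    simp only [hd', hv]
    by_cases h1 : ∀ w ∈ C, copyConfig S 1 w = x w
    · by_cases h2 : copyConfig S 1 v = x v
      · simp only [eq_true h1, h2, and_true, true_and]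
        ring
      · simp only [eq_true h1, h2, false_and, if_false]
        ring
    · simp only [eq_false h1, and_false, if_false]
  · push Not at hC
    obtain ⟨w, hw, hwS⟩ := hC
    -- The two outcomes of the coin differ at `w`, so at most one of them agrees with `x` on `C`.
    have hne : ¬ ((∀ w ∈ C, copyConfig S 0 w = x w) ∧ (∀ w ∈ C, copyConfig S 1 w = x w)) := by
      rintro ⟨h0, h1⟩
      have := (h0 w hw).trans (h1 w hw).symm
      simp [copyConfig, hwS] at this
    rw [not_and_or] at hne
    rcases hne with h1 | h1 <;> simp only [h1, and_false, if_false] <;>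
      split_ifs <;> simp_all

/-- Vertices outside `S` are constantly 0, and constants are independent of everything. -/
theorem condIndep_copyLaw_of_disjoint (S : Set V) {v : V} {B C : Finset V}
    (hB : ∀ w ∈ B, w ∉ S) (hC : ∀ w ∈ C, w ∉ S) : CondIndep (copyLaw S) {v} B C := by
  classical
  intro x
  simp only [marg, pr_copyLaw, Finset.mem_union, Finset.mem_singleton, or_imp, forall_and,
    forall_eq]
  have hd : ∀ D : Finset V, (∀ w ∈ D, w ∉ S) →
      ((∀ w ∈ D, copyConfig S 0 w = x w) ↔ (∀ w ∈ D, copyConfig S 1 w = x w)) := fun D hD =>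
    forall₂_congr fun w hw => by simp [copyConfig, hD w hw]
  simp only [hd B hB, hd C hC]
  by_cases h1 : ∀ w ∈ C, copyConfig S 1 w = x w
  · by_cases h2 : ∀ w ∈ B, copyConfig S 1 w = x w
    · simp only [eq_true h1, eq_true h2, and_true]
    · simp only [eq_true h1, eq_false h2, and_true, and_false, if_false]
      ring
  · simp only [eq_false h1, and_false, if_false]

/-- The source `z` tosses the coin, and by acyclicity its parents and non-descendants lie outside
the copying set. Any other copying vertex has a copying parent, so its value is determined by its
parents. -/
theorem causalMarkov_copyLaw {G : Digraph V} (hG : Acyclic G) (w z : V) :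
    CausalMarkov G (copyLaw {v | ReachAvoiding G w z v}) := by
  intro v
  by_cases hv : v = z
  · subst hv
    refine condIndep_copyLaw_of_disjoint _ ?_ ?_
    · intro u hu h
      simp only [Finset.mem_sdiff, nonDescendants, Finset.mem_filter, Finset.mem_univ,
        true_and] at hu
      exact hu.1 (ReachAvoiding.reach h)
    · intro u hu h
      simp only [parents, Finset.mem_filter, Finset.mem_univ, true_and] at hu
      exact hG v (Relation.TransGen.tail' (ReachAvoiding.reach h) hu)
  · refine condIndep_copyLaw_of_determined _ fun hpa hvS => ?_
    rcases Relation.ReflTransGen.cases_tail hvS with h | ⟨u, hu, huv⟩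
    · exact hv h
    · exact hpa u (by simpa [parents] using huv.1) hu

/-- A common ancestor with paths that avoid `w` makes two variables dependent given `w` in some
Markov law. -/
theorem not_markovEntails {G : Digraph V} (hG : Acyclic G) {x y w z : V} (hxy : x ≠ y)
    (hz : z ≠ w) (hx : ReachAvoiding G w z x) (hy : ReachAvoiding G w z y) :
    ¬ MarkovEntails G {x} {y} {w} := by
  classical
  intro h
  have hc := h _ _ (copyLaw_mem _) (causalMarkov_copyLaw hG w z)
  have hw : ¬ ReachAvoiding G w z w := fun h => h.ne hz rfl
  have hwy : w ≠ y := fun e => hw (e ▸ hy)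
  -- At `y = 1` and all other values 0 the identity would read 0 · 1 = (1/2) · (1/2).
  have := hc (fun v => if v = y then 1 else 0)
  simp [marg, pr_copyLaw, copyConfig, hx, hy, hw, hwy, hxy] at this

end Faithfulness

/-! ### Tensor rank and decompositions of moments -/

section TensorRank

/-- `T` is a sum of `R` outer products. -/
def HasRankLE {N : ℕ} {I : Fin N → ℕ} (T : ((t : Fin N) → Fin (I t)) → ℝ) (R : ℕ) : Prop :=
  ∃ u : Fin R → (t : Fin N) → Fin (I t) → ℝ, ∀ a, T a = ∑ j, ∏ t, u j t (a t)

theorem tensorRank_le {N : ℕ} {I : Fin N → ℕ} {T : ((t : Fin N) → Fin (I t)) → ℝ} {R : ℕ}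
    (h : HasRankLE T R) : tensorRank T ≤ R :=
  Nat.sInf_le h

theorem HasRankLE.tensorRank {N : ℕ} {I : Fin N → ℕ} {T : ((t : Fin N) → Fin (I t)) → ℝ} {R : ℕ}
    (h : HasRankLE T R) : HasRankLE T (tensorRank T) :=
  Nat.sInf_mem (s := {R | HasRankLE T R}) ⟨R, h⟩

theorem hasRankLE_of_tensorRank_eq {N : ℕ} {I : Fin N → ℕ} {T : ((t : Fin N) → Fin (I t)) → ℝ}
    {R : ℕ} (h : tensorRank T = R) (hR : R ≠ 0) : HasRankLE T R := by
  subst h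
  -- The infimum of the empty set is 0, so a nonzero value is attained by a decomposition.
  rcases Set.eq_empty_or_nonempty {R | HasRankLE T R} with h | ⟨R, h⟩
  · exact absurd ((congrArg sInf h).trans Nat.sInf_empty) hR
  · exact HasRankLE.tensorRank h

variable {k m : ℕ}

theorem Model.tensor_obsLaw (M : Model k m) {N : ℕ} (ι : Fin N → Fin m)
    (a : (t : Fin N) → Fin (M.card (Sum.inr (ι t)))) :
    tensor M.obsLaw ι a = pr M.prob (fun y => ∀ t, y (Sum.inr (ι t)) = a t) := by
  classical
  unfold tensor Model.obsLaw
  simp only [pr]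
  rw [Finset.sum_filter, Finset.sum_filter, ← Finset.sum_fiberwise Finset.univ
    (fun (y : Config M.card) (i : Fin m) => y (Sum.inr i))]
  refine Finset.sum_congr rfl fun x _ => ?_
  have : ∀ y : Config M.card, (∀ i, y (Sum.inr i) = x i) ↔
      (fun i : Fin m => y (Sum.inr i)) = x := fun y => funext_iff.symm
  simp only [this]
  by_cases h : ∀ t, x (ι t) = a t
  · rw [if_pos h]
    refine Finset.sum_congr rfl fun y hy => ?_
    rw [if_pos]
    intro t
    rw [← h t, ← (Finset.mem_filter.1 hy).2]
  · rw [if_neg h]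
    refine (Finset.sum_eq_zero fun y hy => if_neg fun h' => h fun t => ?_).symm
    rw [← h' t, ← (Finset.mem_filter.1 hy).2]

/-- A decomposition of a probability tensor splits the moments of the variables. -/
theorem Model.exists_moments (M : Model k m) {N R : ℕ} {ι : Fin N → Fin m}
    (h : HasRankLE (tensor M.obsLaw ι) R) :
    ∃ U : Fin R → Fin N → (ℕ → ℝ) → ℝ, ∀ φ : Fin N → ℕ → ℝ,
      ∑ y, M.prob y * ∏ t, φ t (y (Sum.inr (ι t))) = ∑ j, ∏ t, U j t (φ t) := by
  classical
  obtain ⟨u, hu⟩ := h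
  -- Each vector of the decomposition becomes a linear functional. Test functions live on `ℕ` so
  -- that their type does not depend on the variable.
  refine ⟨fun j t φ => ∑ b : Fin (M.card (Sum.inr (ι t))), φ (b : ℕ) * u j t b, fun φ => ?_⟩
  have h1 : ∀ j, ∏ t, ∑ b : Fin (M.card (Sum.inr (ι t))), φ t (b : ℕ) * u j t b
      = ∑ a : (t : Fin N) → Fin (M.card (Sum.inr (ι t))),
          (∏ t, φ t (a t)) * ∏ t, u j t (a t) := by
    intro j
    rw [Finset.prod_univ_sum, Fintype.piFinset_univ]
    exact Finset.sum_congr rfl fun a _ => Finset.prod_mul_distrib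
  simp_rw [h1]
  rw [Finset.sum_comm]
  simp_rw [← Finset.mul_sum, ← hu, M.tensor_obsLaw, pr_eq_sum_ite, Finset.mul_sum]
  rw [Finset.sum_comm]
  refine Finset.sum_congr rfl fun y _ => ?_
  have : ∀ a : (t : Fin N) → Fin (M.card (Sum.inr (ι t))),
      (∀ t, y (Sum.inr (ι t)) = a t) ↔ (fun t => y (Sum.inr (ι t))) = a :=
    fun a => funext_iff.symm
  simp [this, mul_comm]

end TensorRank

/-! ### Pure children and detection of the latent state -/

section PureChild

variable {k m : ℕ} {M : Model k m}

theorem Model.IsPureChild.parents_eq {l : Fin k} {i : Fin m} (h : M.IsPureChild l i) :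
    parents M.graph (Sum.inr i) = {Sum.inl l} := by
  ext v
  simp only [parents, Finset.mem_filter, Finset.mem_univ, true_and, Finset.mem_singleton]
  exact ⟨h.2.1 v, fun hv => hv ▸ h.1⟩

theorem Model.IsPureChild.not_reach {l : Fin k} {i : Fin m} (h : M.IsPureChild l i)
    {v : Fin k ⊕ Fin m} (hv : Relation.ReflTransGen M.graph.Adj (Sum.inr i) v) :
    v = Sum.inr i := by
  rcases Relation.ReflTransGen.cases_head hv with h' | ⟨w, hw, -⟩
  · exact h'.symm
  · exact absurd hw (h.2.2 w)

theorem Model.IsPureChild.kernel_congr {l : Fin k} {i : Fin m} (h : M.IsPureChild l i)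
    (b : Fin (M.card (Sum.inr i))) {x y : Config M.card} (hxy : x (Sum.inl l) = y (Sum.inl l)) :
    kernel M.graph M.prob (Sum.inr i) b x = kernel M.graph M.prob (Sum.inr i) b y := by
  refine DiscreteLSM.kernel_congr _ _ _ _ fun w hw => ?_
  rw [h.parents_eq, Finset.mem_singleton] at hw
  subst hw
  exact hxy

/-- A pure child may be averaged out against any function of the other variables. -/
theorem Model.IsPureChild.sum_mul_eq {l : Fin k} {i : Fin m} (h : M.IsPureChild l i)
    (hM : CausalMarkov M.graph M.prob) (φ : Fin (M.card (Sum.inr i)) → ℝ) {g : Config M.card → ℝ}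
    (hg : DependsOn g {v | v ≠ Sum.inr i}) :
    ∑ y, M.prob y * (φ (y (Sum.inr i)) * g y)
      = ∑ y, M.prob y * ((∑ b, φ b * kernel M.graph M.prob (Sum.inr i) b y) * g y) := by
  refine sum_mul_eq_sum_kernel M.acyclic M.prob_mem.1 hM _ φ fun x y hxy => hg fun v hv => ?_
  refine hxy v ?_
  simp only [nonDescendants, Finset.coe_filter, Finset.mem_univ, true_and, Set.mem_ofPred_eq]
  exact fun h' => hv (h.not_reach h')

theorem Model.nonempty_config (M : Model k m) : Nonempty (Config M.card) :=
  ⟨fun v => ⟨0, lt_of_lt_of_le (by norm_num) (M.two_le_card v)⟩⟩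

theorem Model.exists_config (M : Model k m) {r : ℕ} {l : Fin k} (hr : M.card (Sum.inl l) = r)
    (c : Fin r) : ∃ y : Config M.card, (y (Sum.inl l) : ℕ) = c := by
  obtain ⟨y⟩ := M.nonempty_config
  exact ⟨Function.update y (Sum.inl l) (Fin.cast hr.symm c), by simp⟩

/-- The columns of a full rank table have a dual family: a function of the child which detects
the state of its latent parent. -/
theorem Model.IsPureChild.exists_dual {l : Fin k} {i : Fin m} (h : M.IsPureChild l i) {r : ℕ}
    (hr : M.card (Sum.inl l) = r) (hF : FullColumnRank M.graph M.prob (Sum.inr i)) :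
    ∃ δ : Fin r → ℕ → ℝ, ∀ (c : Fin r) (y : Config M.card),
      ∑ b : Fin (M.card (Sum.inr i)), δ c (b : ℕ) * kernel M.graph M.prob (Sum.inr i) b y
        = if (y (Sum.inl l) : ℕ) = c then 1 else 0 := by
  classical
  choose Y hY using M.exists_config hr
  have hpa : ∀ x y : Config M.card,
      ParentsAre M.graph (Sum.inr i) (fun w => x w) y ↔ y (Sum.inl l) = x (Sum.inl l) := by
    intro x y
    constructor
    · exact fun h' => h' ⟨_, h.1⟩
    · rintro h' ⟨w, hw⟩
      obtain rfl := h.2.1 w hw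
      exact h'
  have hpos : ∀ x : Config M.card,
      0 < pr M.prob (ParentsAre M.graph (Sum.inr i) (fun w => x w)) := by
    intro x
    have := M.marginal_pos (Sum.inl l) (x (Sum.inl l))
    rwa [show ParentsAre M.graph (Sum.inr i) (fun w => x w) =
      fun y => y (Sum.inl l) = x (Sum.inl l) from funext fun y => propext (hpa x y)]
  have hker : ∀ (x : Config M.card) (b : Fin (M.card (Sum.inr i))),
      pr M.prob (fun y => y (Sum.inr i) = b ∧
          ParentsAre M.graph (Sum.inr i) (fun w => x w) y) /
        pr M.prob (ParentsAre M.graph (Sum.inr i) (fun w => x w))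
        = kernel M.graph M.prob (Sum.inr i) b x := by
    intro x b
    unfold kernel marg
    rw [h.parents_eq]
    simp [funext (fun y => propext (hpa x y))]
  -- Every state of `l` has positive probability, so all `r` states give distinct columns of the
  -- table.
  have hinj : Function.Injective (fun c : Fin r =>
      (⟨fun w => Y c w, hpos (Y c)⟩ : {c : (w : {w // M.graph.Adj w (Sum.inr i)}) →
        Fin (M.card w) // 0 < pr M.prob (ParentsAre M.graph (Sum.inr i) c)})) := by
    intro c c' hcc
    have := congrFun (congrArg Subtype.val hcc) ⟨Sum.inl l, h.1⟩
    simp only at this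
    exact Fin.ext (by rw [← hY c, ← hY c', this])
  have hli := LinearIndependent.comp hF _ hinj
  have hfun : (fun c : Fin r => fun b => kernel M.graph M.prob (Sum.inr i) b (Y c))
      = ((fun (c : {c : (w : {w // M.graph.Adj w (Sum.inr i)}) → Fin (M.card w) //
          0 < pr M.prob (ParentsAre M.graph (Sum.inr i) c)}) (a : Fin (M.card (Sum.inr i))) =>
        pr M.prob (fun x => x (Sum.inr i) = a ∧ ParentsAre M.graph (Sum.inr i) c.1 x) /
          pr M.prob (ParentsAre M.graph (Sum.inr i) c.1)) ∘ (fun c : Fin r =>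
      (⟨fun w => Y c w, hpos (Y c)⟩ : {c : (w : {w // M.graph.Adj w (Sum.inr i)}) →
        Fin (M.card w) // 0 < pr M.prob (ParentsAre M.graph (Sum.inr i) c)}))) := by
    funext c b
    exact (hker (Y c) b).symm
  rw [← hfun] at hli
  -- Independent columns have a left inverse, whose rows are the detecting functions.
  obtain ⟨g, hg⟩ := LinearMap.exists_leftInverse_of_injective
    (Fintype.linearCombination ℝ
      (fun c : Fin r => fun b => kernel M.graph M.prob (Sum.inr i) b (Y c)))
    (LinearMap.ker_eq_bot.2 hli.fintypeLinearCombination_injective)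
  -- The value 0 beyond the states of the child is never used.
  refine ⟨fun c n => if hn : n < M.card (Sum.inr i) then g (Pi.single ⟨n, hn⟩ 1) c else 0,
    fun c y => ?_⟩
  have hlt : (y (Sum.inl l) : ℕ) < r := hr ▸ (y (Sum.inl l)).2
  have hyc : y (Sum.inl l) = Y ⟨_, hlt⟩ (Sum.inl l) := Fin.ext (hY ⟨_, hlt⟩).symm
  set c' : Fin r := ⟨_, hlt⟩ with hc'
  have e := congrFun (LinearMap.congr_fun hg (Pi.single c' 1)) c
  rw [LinearMap.comp_apply, Fintype.linearCombination_apply_single, one_smul,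
    LinearMap.id_apply, LinearMap.pi_apply_eq_sum_univ g] at e
  simp only [Finset.sum_apply, Pi.smul_apply, smul_eq_mul] at e
  calc _ = ∑ b, kernel M.graph M.prob (Sum.inr i) b (Y c') * g (Pi.single b 1) c := by
        refine Finset.sum_congr rfl fun b _ => ?_
        rw [h.kernel_congr b hyc, mul_comm]
        exact congrArg (_ * ·) (dif_pos b.2)
    _ = _ := by
        have hs : ∀ b : Fin (M.card (Sum.inr i)),
            (fun j => if b = j then (1 : ℝ) else 0) = Pi.single b 1 := by
          intro b; funext j; simp [Pi.single_apply, eq_comm]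
        simp only [hs] at e
        rw [e, Pi.single_apply]
        refine if_congr ?_ rfl rfl
        rw [Fin.ext_iff, hc', eq_comm]

end PureChild

/-! ### Simultaneous factorization of diagonal matrices -/

section MatrixLemma

open Matrix in
/-- If `A diag(β' χ') Bᵀ = diag d` is invertible, then the diagonal matrices
`A diag(β χ) Bᵀ (diag d)⁻¹` multiply like the vectors `β` and `χ`. -/
theorem diagonal_mul_of_square {r : ℕ} (A B : Fin r → Fin r → ℝ) (b b' c c' : Fin r → ℝ)
    (d e f g : Fin r → ℝ) (hd : ∀ i, d i ≠ 0)
    (h1 : ∀ i i', ∑ j, A j i * B j i' * (b' j * c' j) = if i = i' then d i else 0)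
    (h2 : ∀ i i', ∑ j, A j i * B j i' * (b j * c j) = if i = i' then e i else 0)
    (h3 : ∀ i i', ∑ j, A j i * B j i' * (b j * c' j) = if i = i' then f i else 0)
    (h4 : ∀ i i', ∑ j, A j i * B j i' * (b' j * c j) = if i = i' then g i else 0) (i : Fin r) :
    e i * d i = f i * g i := by
  have conv : ∀ x y z : Fin r → ℝ,
      (∀ i i', ∑ j, A j i * B j i' * (x j * y j) = if i = i' then z i else 0) →
      (Matrix.of A)ᵀ * diagonal (fun j => x j * y j) * Matrix.of B = diagonal z := by
    intro x y z h
    ext i i'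
    rw [Matrix.mul_apply, diagonal_apply, ← h]
    refine Finset.sum_congr rfl fun j _ => ?_
    rw [mul_diagonal, transpose_apply, of_apply, of_apply]
    ring
  have k1 := conv _ _ _ h1
  have k2 := conv _ _ _ h2
  have k3 := conv _ _ _ h3
  have k4 := conv _ _ _ h4
  set U := (Matrix.of A)ᵀ
  set W := Matrix.of B
  have hdd : diagonal d * diagonal (fun i => (d i)⁻¹) = 1 := by
    rw [diagonal_mul_diagonal]
    simp [hd]
  -- All matrices are square, so a one-sided inverse is two-sided and the factors may be rotated:
  -- `X` inverts `diagonal (b' c')` and is itself diagonal.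
  set X := W * diagonal (fun i => (d i)⁻¹) * U with hX
  have hDX : diagonal (fun j => b' j * c' j) * X = 1 := by
    have : U * (diagonal (fun j => b' j * c' j) * (W * diagonal (fun i => (d i)⁻¹))) = 1 := by
      rw [← hdd, ← k1]
      simp only [Matrix.mul_assoc]
    have := mul_eq_one_comm.1 this
    rw [hX]
    simpa only [Matrix.mul_assoc] using this
  have hXe : ∀ j j', (b' j * c' j) * X j j' = if j = j' then 1 else 0 := by
    intro j j'
    have := congrArg (fun Z : Matrix (Fin r) (Fin r) ℝ => Z j j') hDX
    simpa only [diagonal_mul, Matrix.one_apply] using this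
  have hkey : diagonal (fun j => b j * c' j) * X * diagonal (fun j => b' j * c j)
      = diagonal (fun j => b j * c j) := by
    ext j j'
    rw [mul_diagonal, diagonal_mul, diagonal_apply]
    have hne : b' j * c' j ≠ 0 := by
      intro h0
      have := hXe j j
      rw [h0, zero_mul, if_pos rfl] at this
      exact zero_ne_one this
    split_ifs with hjj
    · subst hjj
      have := hXe j j
      rw [if_pos rfl] at this
      linear_combination (b j * c j) * this
    · have := hXe j j'
      rw [if_neg hjj] at this
      rw [(mul_eq_zero.1 this).resolve_left hne]
      ring
  -- Sandwiching `hkey` between `U` and `W` turns it into an identity between the given diagonal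
  -- matrices.
  have hfin : diagonal f * diagonal (fun i => (d i)⁻¹) * diagonal g = diagonal e := by
    rw [← k3, ← k4, ← k2, ← hkey, hX]
    simp only [Matrix.mul_assoc]
  rw [diagonal_mul_diagonal, diagonal_mul_diagonal] at hfin
  have := congrFun (diagonal_injective hfin) i
  rw [← this]
  field_simp [hd i]

end MatrixLemma

/-! ### The rank of tensors of siblings -/

section Siblings

variable {k m : ℕ} {M : Model k m}

/-- Integrating out the child turns its detecting function into the indicator of the latent state.
-/
theorem Model.IsPureChild.sum_dual_mul {l : Fin k} {i : Fin m} (h : M.IsPureChild l i)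
    (hM : CausalMarkov M.graph M.prob) {δ : ℕ → ℝ} {c : ℕ}
    (hδ : ∀ y : Config M.card, ∑ b : Fin (M.card (Sum.inr i)),
      δ (b : ℕ) * kernel M.graph M.prob (Sum.inr i) b y = if (y (Sum.inl l) : ℕ) = c then 1 else 0)
    {g : Config M.card → ℝ} (hg : DependsOn g {v | v ≠ Sum.inr i}) :
    ∑ y, M.prob y * (δ (y (Sum.inr i)) * g y)
      = ∑ y, M.prob y * ((if (y (Sum.inl l) : ℕ) = c then 1 else 0) * g y) := by
  rw [h.sum_mul_eq hM (fun b => δ (b : ℕ)) hg]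
  exact Finset.sum_congr rfl fun y _ => by rw [hδ]

/-- Detecting the latent parent twice through two of its children. -/
theorem Model.IsPureChild.sum_dual_mul_dual_mul {l : Fin k} {i i' : Fin m}
    (h : M.IsPureChild l i) (h' : M.IsPureChild l i') (hne : i ≠ i')
    (hM : CausalMarkov M.graph M.prob) {δ δ' : ℕ → ℝ} {c c' : ℕ}
    (hδ : ∀ y : Config M.card, ∑ b : Fin (M.card (Sum.inr i)),
      δ (b : ℕ) * kernel M.graph M.prob (Sum.inr i) b y = if (y (Sum.inl l) : ℕ) = c then 1 else 0)
    (hδ' : ∀ y : Config M.card, ∑ b : Fin (M.card (Sum.inr i')),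
      δ' (b : ℕ) * kernel M.graph M.prob (Sum.inr i') b y
        = if (y (Sum.inl l) : ℕ) = c' then 1 else 0)
    {g : Config M.card → ℝ} (hg : DependsOn g {v | v ≠ Sum.inr i})
    (hg' : DependsOn g {v | v ≠ Sum.inr i'}) :
    ∑ y, M.prob y * (δ (y (Sum.inr i)) * δ' (y (Sum.inr i')) * g y)
      = if c = c' then ∑ y, M.prob y * ((if (y (Sum.inl l) : ℕ) = c then 1 else 0) * g y)
        else 0 := by
  have e1 := h.sum_dual_mul hM hδ (g := fun y => δ' (y (Sum.inr i')) * g y) (by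
    intro x y hxy
    have : x (Sum.inr i') = y (Sum.inr i') := hxy _ (by simpa using hne.symm)
    simp only [this, hg hxy])
  have e2 := h'.sum_dual_mul hM hδ'
    (g := fun y => (if (y (Sum.inl l) : ℕ) = c then 1 else 0) * g y) (by
    intro x y hxy
    have : x (Sum.inl l) = y (Sum.inl l) := hxy _ (by simp)
    simp only [this, hg' hxy])
  calc _ = ∑ y, M.prob y * (δ (y (Sum.inr i)) * (δ' (y (Sum.inr i')) * g y)) :=
        Finset.sum_congr rfl fun y _ => by ring
    _ = ∑ y, M.prob y * (δ' (y (Sum.inr i')) *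
          ((if (y (Sum.inl l) : ℕ) = c then 1 else 0) * g y)) := by
        rw [e1]
        exact Finset.sum_congr rfl fun y _ => by ring
    _ = _ := by
        rw [e2]
        split_ifs with hc
        · subst hc
          refine Finset.sum_congr rfl fun y _ => ?_
          split_ifs <;> simp
        · refine Finset.sum_eq_zero fun y _ => ?_
          by_cases h1 : (y (Sum.inl l) : ℕ) = c <;> simp [h1, hc]

theorem Model.sum_latent_pos (M : Model k m) {r : ℕ} {l : Fin k}
    (hr : M.card (Sum.inl l) = r) (c : Fin r) :
    0 < ∑ y, M.prob y * (if (y (Sum.inl l) : ℕ) = c then 1 else 0) := by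
  have := M.marginal_pos (Sum.inl l) (Fin.cast hr.symm c)
  rw [pr_eq_sum_ite] at this
  refine this.trans_eq (Finset.sum_congr rfl fun y _ => ?_)
  by_cases hy : y (Sum.inl l) = Fin.cast hr.symm c
  · rw [if_pos hy, if_pos (by rw [hy]; rfl)]
  · rw [if_neg hy, if_neg fun h : (y (Sum.inl l) : ℕ) = c => hy (Fin.ext h)]

/-- Two children of a latent variable force the rank to be at least its number of states. -/
theorem Model.le_of_hasRankLE {r R N : ℕ} {l : Fin k} (hr : M.card (Sum.inl l) = r)
    (hM : CausalMarkov M.graph M.prob)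
    (hF : ∀ i : Fin m, FullColumnRank M.graph M.prob (Sum.inr i)) {ι : Fin (N + 2) → Fin m}
    (h0 : M.IsPureChild l (ι 0)) (h1 : M.IsPureChild l (ι 1)) (hne : ι 0 ≠ ι 1)
    (h : HasRankLE (tensor M.obsLaw ι) R) : r ≤ R := by
  obtain ⟨U, hU⟩ := M.exists_moments h
  obtain ⟨δ, hδ⟩ := h0.exists_dual hr (hF _)
  obtain ⟨δ', hδ'⟩ := h1.exists_dual hr (hF _)
  let d : Fin r → ℝ := fun c => ∑ y, M.prob y * (if (y (Sum.inl l) : ℕ) = c then 1 else 0)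
  -- Detecting functions in the first two slots and the constant 1 in the others: `diagonal d`
  -- factors through dimension `R`.
  have key : ∀ c c' : Fin r, ∑ j, U j 0 (δ c) * (U j 1 (δ' c') *
      ∏ t : Fin N, U j t.succ.succ (fun _ => 1)) = if c = c' then d c else 0 := by
    intro c c'
    have e1 := hU (Fin.cons (δ c) (Fin.cons (δ' c') fun _ _ => 1))
    simp only [Fin.prod_univ_succ, Fin.cons_zero, Fin.cons_succ, Finset.prod_const_one,
      mul_one] at e1
    have e2 := h0.sum_dual_mul_dual_mul h1 hne hM (hδ c) (hδ' c') (g := fun _ => 1)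
      (fun _ _ _ => rfl) (fun _ _ _ => rfl)
    simp only [mul_one, Fin.val_inj] at e2
    exact e1.symm.trans e2
  let A : Matrix (Fin r) (Fin R) ℝ := Matrix.of fun c j => U j 0 (δ c)
  let B : Matrix (Fin R) (Fin r) ℝ := Matrix.of fun j c =>
    U j 1 (δ' c) * ∏ t : Fin N, U j t.succ.succ (fun _ => 1)
  have hAB : A * B = Matrix.diagonal d := by
    ext c c'
    rw [Matrix.mul_apply, Matrix.diagonal_apply, ← key]
    rfl
  have hrank : (Matrix.diagonal d).rank = r := by
    rw [Matrix.rank_of_isUnit, Fintype.card_fin]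
    rw [Matrix.isUnit_diagonal, Pi.isUnit_iff]
    exact fun c => (M.sum_latent_pos hr c).ne'.isUnit
  rw [← hrank, ← hAB]
  calc _ ≤ B.rank := Matrix.rank_mul_le_right A B
    _ ≤ Fintype.card (Fin R) := Matrix.rank_le_card_height B
    _ = R := Fintype.card_fin R

/-- If all but one of the variables are children of the same latent variable, then the rank is at
most its number of states. -/
theorem Model.hasRankLE_of_siblings {r N : ℕ} {l : Fin k} (hr : M.card (Sum.inl l) = r)
    (hM : CausalMarkov M.graph M.prob) {ι : Fin N → Fin m} (hι : Function.Injective ι)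
    (t₀ : Fin N) (h : ∀ t, t ≠ t₀ → M.IsPureChild l (ι t)) :
    HasRankLE (tensor M.obsLaw ι) r := by
  classical
  choose Y hY using M.exists_config hr
  -- The factor at `t₀` is the joint probability with the state `j`, so it also carries the weight
  -- P(L = j).
  refine ⟨fun j t b => if t = t₀ then ∑ y, M.prob y * ((if (y (Sum.inl l) : ℕ) = j then 1 else 0) *
      (if y (Sum.inr (ι t)) = b then 1 else 0))
    else kernel M.graph M.prob (Sum.inr (ι t)) b (Y j), fun a => ?_⟩
  -- The indicators of the children are replaced by kernels one at a time; slot `t₀`, perhaps not a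
  -- child of `l`, keeps its indicator.
  have step : ∀ s : Finset (Fin N), t₀ ∉ s → tensor M.obsLaw ι a =
      ∑ y, M.prob y * ∏ t, if t ∈ s then kernel M.graph M.prob (Sum.inr (ι t)) (a t) y
        else if y (Sum.inr (ι t)) = a t then 1 else 0 := by
    intro s
    induction s using Finset.induction_on with
    | empty =>
      intro _
      rw [M.tensor_obsLaw, pr_eq_sum_ite]
      refine Finset.sum_congr rfl fun y _ => ?_
      simp only [Finset.notMem_empty, if_false]
      rw [Finset.prod_ite_zero]
      simp
    | insert u s hu ih =>
      intro ht
      rw [Finset.mem_insert, not_or] at ht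
      rw [ih ht.2]
      have hu' := h u (Ne.symm ht.1)
      have hsplit : ∀ (f : Fin N → ℝ), ∏ t, f t = f u * ∏ t ∈ Finset.univ.erase u, f t :=
        fun f => (Finset.mul_prod_erase _ f (Finset.mem_univ u)).symm
      let g : Config M.card → ℝ := fun y => ∏ t ∈ Finset.univ.erase u,
        if t ∈ s then kernel M.graph M.prob (Sum.inr (ι t)) (a t) y
        else if y (Sum.inr (ι t)) = a t then 1 else 0
      have hg : DependsOn g {v | v ≠ Sum.inr (ι u)} := by
        intro x y hxy
        refine Finset.prod_congr rfl fun t ht' => ?_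
        have htu := Finset.ne_of_mem_erase ht'
        by_cases hts : t ∈ s
        · rw [if_pos hts, if_pos hts]
          refine (h t ?_).kernel_congr _ (hxy _ (by simp))
          rintro rfl
          exact ht.2 hts
        · rw [if_neg hts, if_neg hts, hxy (Sum.inr (ι t)) (by simpa using hι.ne htu)]
      have := hu'.sum_mul_eq hM (fun b => if b = a u then 1 else 0) hg
      simp only [ite_mul, one_mul, zero_mul, Finset.sum_ite_eq', Finset.mem_univ, if_true] at this
      refine Eq.trans (Finset.sum_congr rfl fun y _ => ?_)
        (this.trans (Finset.sum_congr rfl fun y _ => ?_))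
      · rw [hsplit, if_neg hu, ite_mul, one_mul, zero_mul]
      · rw [hsplit, if_pos (Finset.mem_insert_self u s)]
        congr 2
        refine Finset.prod_congr rfl fun t ht' => ?_
        simp [Finset.ne_of_mem_erase ht']
  rw [step (Finset.univ.erase t₀) (by simp)]
  have hsplit : ∀ (f : Fin N → ℝ), ∏ t, f t = f t₀ * ∏ t ∈ Finset.univ.erase t₀, f t :=
    fun f => (Finset.mul_prod_erase _ f (Finset.mem_univ t₀)).symm
  -- The kernels depend only on the state of `l`, so the product splits according to that state.
  have e1 : ∀ y : Config M.card, (∏ t, if t ∈ Finset.univ.erase t₀ then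
        kernel M.graph M.prob (Sum.inr (ι t)) (a t) y
        else if y (Sum.inr (ι t)) = a t then 1 else 0)
      = ∑ j : Fin r, (if (y (Sum.inl l) : ℕ) = j then 1 else 0) *
        ((if y (Sum.inr (ι t₀)) = a t₀ then 1 else 0) *
          ∏ t ∈ Finset.univ.erase t₀, kernel M.graph M.prob (Sum.inr (ι t)) (a t) (Y j)) := by
    intro y
    have hlt : (y (Sum.inl l) : ℕ) < r := hr ▸ (y (Sum.inl l)).2
    rw [Finset.sum_eq_single (⟨_, hlt⟩ : Fin r), if_pos rfl, one_mul, hsplit]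
    · congr 1
      · simp
      · refine Finset.prod_congr rfl fun t ht => ?_
        rw [if_pos ht]
        exact (h t (Finset.ne_of_mem_erase ht)).kernel_congr _ (Fin.ext (hY ⟨_, hlt⟩).symm)
    · intro j _ hj
      rw [if_neg, zero_mul]
      intro h'
      exact hj (Fin.ext h'.symm)
    · simp
  simp_rw [e1, Finset.mul_sum]
  rw [Finset.sum_comm]
  refine Finset.sum_congr rfl fun j _ => ?_
  rw [hsplit, if_pos rfl, Finset.sum_mul]
  refine Finset.sum_congr rfl fun y _ => ?_
  have : ∏ t ∈ Finset.univ.erase t₀, (if t = t₀ then ∑ y, M.prob y *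
      ((if (y (Sum.inl l) : ℕ) = j then 1 else 0) * (if y (Sum.inr (ι t)) = a t then 1 else 0))
      else kernel M.graph M.prob (Sum.inr (ι t)) (a t) (Y j))
      = ∏ t ∈ Finset.univ.erase t₀, kernel M.graph M.prob (Sum.inr (ι t)) (a t) (Y j) :=
    Finset.prod_congr rfl fun t ht => if_neg (Finset.ne_of_mem_erase ht)
  rw [this]
  ring

/-- The lower bound uses two siblings in the slots 0 and 1, so the exceptional slot `t₀` must be
another one. -/
theorem Model.tensorRank_siblings {r N : ℕ} {l : Fin k} (hr : M.card (Sum.inl l) = r)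
    (hM : CausalMarkov M.graph M.prob)
    (hF : ∀ i : Fin m, FullColumnRank M.graph M.prob (Sum.inr i)) {ι : Fin (N + 2) → Fin m}
    (hι : Function.Injective ι) (t₀ : Fin (N + 2)) (ht0 : 0 ≠ t₀) (ht1 : 1 ≠ t₀)
    (h : ∀ t, t ≠ t₀ → M.IsPureChild l (ι t)) :
    tensorRank (tensor M.obsLaw ι) = r := by
  have hle := M.hasRankLE_of_siblings hr hM hι t₀ h
  exact le_antisymm (tensorRank_le hle) (Model.le_of_hasRankLE hr hM hF (h 0 ht0) (h 1 ht1)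
    (hι.ne (by simp)) hle.tensorRank)

end Siblings

/-! ### Conditional independence from rank `r` -/

section Splits

variable {k m : ℕ} {M : Model k m}

/-- The joint moments of four observed variables are those of a tensor of rank at most `r`. -/
def Model.Splits (M : Model k m) (r : ℕ) (i j s t : Fin m) : Prop :=
  ∃ U₁ U₂ U₃ U₄ : Fin r → (ℕ → ℝ) → ℝ, ∀ A B C D : ℕ → ℝ,
    ∑ y, M.prob y * (A (y (Sum.inr i)) * B (y (Sum.inr j)) *
      (C (y (Sum.inr s)) * D (y (Sum.inr t))))
      = ∑ a, U₁ a A * U₂ a B * (U₃ a C * U₄ a D)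

theorem Model.splits_of_hasRankLE {r : ℕ} {i j s t : Fin m}
    (h : HasRankLE (tensor M.obsLaw ![i, j, s, t]) r) : M.Splits r i j s t := by
  obtain ⟨U, hU⟩ := M.exists_moments h
  refine ⟨fun a => U a 0, fun a => U a 1, fun a => U a 2, fun a => U a 3, fun A B C D => ?_⟩
  have := hU ![A, B, C, D]
  simp only [Fin.prod_univ_four] at this
  refine Eq.trans (Finset.sum_congr rfl fun y _ => ?_)
    (this.trans (Finset.sum_congr rfl fun y _ => ?_))
  · show _ = M.prob y * (A (y (Sum.inr i)) * B (y (Sum.inr j)) * C (y (Sum.inr s)) *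
      D (y (Sum.inr t)))
    ring
  · show U y 0 A * U y 1 B * U y 2 C * U y 3 D = _
    ring

/-- The three adjacent transpositions together bring any two siblings into the first two slots, as
`Model.Splits.condIndep` requires. -/
theorem Model.Splits.swap_first {r : ℕ} {i j s t : Fin m} (h : M.Splits r i j s t) :
    M.Splits r j i s t := by
  obtain ⟨U₁, U₂, U₃, U₄, h⟩ := h
  refine ⟨U₂, U₁, U₃, U₄, fun A B C D => ?_⟩
  have := h B A C D
  simpa only [mul_comm (B _) (A _), mul_comm (U₁ _ _) (U₂ _ _)] using this

theorem Model.Splits.swap_middle {r : ℕ} {i j s t : Fin m} (h : M.Splits r i j s t) :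
    M.Splits r i s j t := by
  obtain ⟨U₁, U₂, U₃, U₄, h⟩ := h
  refine ⟨U₁, U₃, U₂, U₄, fun A B C D => ?_⟩
  have := h A C B D
  simpa only [mul_mul_mul_comm (A _) (C _), mul_mul_mul_comm (U₁ _ _) (U₂ _ _)] using this

theorem Model.Splits.swap_last {r : ℕ} {i j s t : Fin m} (h : M.Splits r i j s t) :
    M.Splits r i j t s := by
  obtain ⟨U₁, U₂, U₃, U₄, h⟩ := h
  refine ⟨U₁, U₂, U₄, U₃, fun A B C D => ?_⟩
  have := h A B D C
  simpa only [mul_comm (D _) (C _), mul_comm (U₃ _ _) (U₄ _ _)] using this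

/-- Two children of a latent variable with `r` states in a 4-way tensor of rank `r`
make the other two variables independent given that latent variable. -/
theorem Model.Splits.condIndep {r : ℕ} {l : Fin k} {i j s t : Fin m} (h : M.Splits r i j s t)
    (hr : M.card (Sum.inl l) = r) (hM : CausalMarkov M.graph M.prob)
    (hF : ∀ i : Fin m, FullColumnRank M.graph M.prob (Sum.inr i)) (hi : M.IsPureChild l i)
    (hj : M.IsPureChild l j) (hij : i ≠ j) (his : i ≠ s) (hit : i ≠ t) (hjs : j ≠ s)
    (hjt : j ≠ t) : CondIndep M.prob {Sum.inr s} {Sum.inr t} {Sum.inl l} := by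
  classical
  obtain ⟨U₁, U₂, U₃, U₄, h⟩ := h
  obtain ⟨δ, hδ⟩ := hi.exists_dual hr (hF _)
  obtain ⟨δ', hδ'⟩ := hj.exists_dual hr (hF _)
  intro x
  let E : (ℕ → ℝ) → (ℕ → ℝ) → Fin r → ℝ := fun C D c =>
    ∑ y, M.prob y * ((if (y (Sum.inl l) : ℕ) = c then 1 else 0) *
      (C (y (Sum.inr s)) * D (y (Sum.inr t))))
  -- The two detectors agree only when `c = c'`, so for all `C` and `D` the decomposition yields a
  -- diagonal matrix, with the same outer factors.
  have key : ∀ (C D : ℕ → ℝ) (c c' : Fin r),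
      ∑ a, U₁ a (δ c) * U₂ a (δ' c') * (U₃ a C * U₄ a D) = if c = c' then E C D c else 0 := by
    intro C D c c'
    rw [← h, hi.sum_dual_mul_dual_mul hj hij hM (hδ c) (hδ' c')]
    · simp only [Fin.val_inj, E]
    · intro y z hyz
      simp only [hyz (Sum.inr s) (by simpa using his.symm),
        hyz (Sum.inr t) (by simpa using hit.symm)]
    · intro y z hyz
      simp only [hyz (Sum.inr s) (by simpa using hjs.symm),
        hyz (Sum.inr t) (by simpa using hjt.symm)]
  let C : ℕ → ℝ := fun n => if n = x (Sum.inr s) then 1 else 0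
  let D : ℕ → ℝ := fun n => if n = x (Sum.inr t) then 1 else 0
  let o : ℕ → ℝ := fun _ => 1
  have hd : ∀ c, E o o c ≠ 0 := by
    intro c
    have := M.sum_latent_pos hr c
    simp only [E, o, mul_one]
    exact this.ne'
  -- With indicators `C`, `D` and the constant `o`, the conclusion is P(s,t,c) P(c) = P(s,c) P(t,c).
  have hfin := diagonal_mul_of_square (fun a c => U₁ a (δ c)) (fun a c => U₂ a (δ' c))
    (fun a => U₃ a C) (fun a => U₃ a o) (fun a => U₄ a D) (fun a => U₄ a o)
    (E o o) (E C D) (E C o) (E o D) hd (key o o) (key C D) (key C o) (key o D)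
    ⟨x (Sum.inl l), hr ▸ (x (Sum.inl l)).2⟩
  have hmarg : ∀ (S : Finset (Fin k ⊕ Fin m)) (C' D' : ℕ → ℝ),
      (∀ y : Config M.card, (if ∀ v ∈ S, y v = x v then (1 : ℝ) else 0) =
        (if (y (Sum.inl l) : ℕ) = x (Sum.inl l) then 1 else 0) *
          (C' (y (Sum.inr s)) * D' (y (Sum.inr t)))) →
      marg M.prob S x = E C' D' ⟨x (Sum.inl l), hr ▸ (x (Sum.inl l)).2⟩ := by
    intro S C' D' hS
    unfold marg
    rw [pr_eq_sum_ite]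
    refine Finset.sum_congr rfl fun y _ => ?_
    rw [← hS y]
    congr
  rw [hmarg _ C D, hmarg {Sum.inl l} o o, hmarg ({Sum.inr s} ∪ {Sum.inl l}) C o,
    hmarg ({Sum.inr t} ∪ {Sum.inl l}) o D, hfin]
  all_goals
    intro y
    simp only [C, D, o, Finset.mem_union, Finset.mem_singleton, or_imp, forall_and, forall_eq,
      Fin.val_inj]
    by_cases h1 : y (Sum.inl l) = x (Sum.inl l) <;>
      by_cases h2 : y (Sum.inr s) = x (Sum.inr s) <;>
      by_cases h3 : y (Sum.inr t) = x (Sum.inr t) <;> simp [h1, h2, h3]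

end Splits

/-! ### Graphical consequences of independence -/

section Separation

variable {k m : ℕ} {M : Model k m}

/-- Faithfulness: variables that are independent given `L` have no common ancestor whose paths
avoid `L`. -/
theorem Model.no_avoiding_ancestor (hFa : Faithful M.graph M.prob) {l a b : Fin k} {s t : Fin m}
    (hst : s ≠ t) (hs : M.IsPureChild a s) (ht : M.IsPureChild b t)
    (h : CondIndep M.prob {Sum.inr s} {Sum.inr t} {Sum.inl l}) (z : Fin k ⊕ Fin m)
    (hz : z ≠ Sum.inl l) (hza : ReachAvoiding M.graph (Sum.inl l) z (Sum.inl a))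
    (hzb : ReachAvoiding M.graph (Sum.inl l) z (Sum.inl b)) : False := by
  refine not_markovEntails M.acyclic (x := Sum.inr s) (y := Sum.inr t) (by simpa using hst) hz
    (hza.tail ⟨hs.1, by simp⟩) (hzb.tail ⟨ht.1, by simp⟩) (hFa _ _ _ ?_ ?_ ?_ h)
  · simpa using hst
  · simp
  · simp

/-- Children of latent variables without common ancestors have no common ancestors. -/
theorem Model.IsPureChild.no_common_ancestor {a b : Fin k} {s t : Fin m} (hst : s ≠ t)
    (hs : M.IsPureChild a s) (ht : M.IsPureChild b t)
    (h : ∀ z, Relation.ReflTransGen M.graph.Adj z (Sum.inl a) →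
      Relation.ReflTransGen M.graph.Adj z (Sum.inl b) → False) (z : Fin k ⊕ Fin m)
    (hzs : Relation.ReflTransGen M.graph.Adj z (Sum.inr s))
    (hzt : Relation.ReflTransGen M.graph.Adj z (Sum.inr t)) : False := by
  rcases Relation.ReflTransGen.cases_tail hzs with h1 | ⟨u, hu, hus⟩
  · subst h1
    exact hst (by simpa using (hs.not_reach hzt).symm)
  · rcases Relation.ReflTransGen.cases_tail hzt with h2 | ⟨w, hw, hwt⟩
    · subst h2
      exact hst (by simpa using ht.not_reach hzs)
    · obtain rfl := hs.2.1 u hus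
      obtain rfl := ht.2.1 w hwt
      exact h z hu hw

/-- Three observed variables without common ancestors have a tensor of rank at most one. -/
theorem Model.hasRankLE_one (hM : CausalMarkov M.graph M.prob) {ι : Fin 3 → Fin m}
    (h : ∀ t t', t ≠ t' → ∀ z, Relation.ReflTransGen M.graph.Adj z (Sum.inr (ι t)) →
      Relation.ReflTransGen M.graph.Adj z (Sum.inr (ι t')) → False) :
    HasRankLE (tensor M.obsLaw ι) 1 := by
  classical
  refine ⟨fun _ t b => ∑ y, M.prob y * (if y (Sum.inr (ι t)) = b then 1 else 0), fun a => ?_⟩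
  -- The ancestor sets of the three variables are closed under parents and pairwise disjoint, so the
  -- indicators factor out one after the other.
  let An : Fin 3 → Finset (Fin k ⊕ Fin m) := fun t =>
    Finset.univ.filter fun z => Relation.ReflTransGen M.graph.Adj z (Sum.inr (ι t))
  let f : Fin 3 → Config M.card → ℝ := fun t y => if y (Sum.inr (ι t)) = a t then 1 else 0
  have hAn : ∀ t u w, M.graph.Adj u w → w ∈ An t → u ∈ An t := by
    intro t u w huw hw
    simp only [An, Finset.mem_filter, Finset.mem_univ, true_and] at hw ⊢
    exact hw.head huw
  have hdis : ∀ t t', t ≠ t' → Disjoint (An t) (An t') := by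
    intro t t' htt
    refine Finset.disjoint_left.2 fun z hz hz' => ?_
    simp only [An, Finset.mem_filter, Finset.mem_univ, true_and] at hz hz'
    exact h t t' htt z hz hz'
  have hf : ∀ t (B : Finset (Fin k ⊕ Fin m)), An t ⊆ B → DependsOn (f t) (B : Set _) := by
    intro t B hB x y hxy
    have : x (Sum.inr (ι t)) = y (Sum.inr (ι t)) := by
      refine hxy _ (hB ?_)
      simp only [An, Finset.mem_filter, Finset.mem_univ, true_and]
      exact .refl
    simp only [f, this]
  have hP := M.prob_mem
  have e1 := sum_mul_mul_of_ancestral M.acyclic hP.1 hP.2 hM (B := An 1 ∪ An 2)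
    (fun u w huw hw => by
      rcases Finset.mem_union.1 hw with hw | hw
      · exact Finset.mem_union_left _ (hAn _ _ _ huw hw)
      · exact Finset.mem_union_right _ (hAn _ _ _ huw hw))
    (g := fun y => f 1 y * f 2 y)
    (fun x y hxy => by
      simp only [hf 1 _ Finset.subset_union_left hxy, hf 2 _ Finset.subset_union_right hxy])
    (An 0) (hAn 0)
    (Finset.disjoint_union_right.2 ⟨hdis 0 1 (by decide), hdis 0 2 (by decide)⟩)
    (hf 0 _ (Finset.Subset.refl _))
  have e2 := sum_mul_mul_of_ancestral M.acyclic hP.1 hP.2 hM (hAn 2)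
    (hf 2 _ (Finset.Subset.refl _)) (An 1) (hAn 1) (hdis 1 2 (by decide))
    (hf 1 _ (Finset.Subset.refl _))
  rw [M.tensor_obsLaw, pr_eq_sum_ite, Finset.sum_const, Finset.card_univ, Fintype.card_fin,
    one_smul, Fin.prod_univ_three, mul_assoc]
  refine Eq.trans (Finset.sum_congr rfl fun y _ => ?_) (e1.trans (congrArg _ e2))
  simp only [f, Fin.forall_fin_succ]
  by_cases h1 : y (Sum.inr (ι 0)) = a 0 <;> by_cases h2 : y (Sum.inr (ι 1)) = a 1 <;>
    by_cases h3 : y (Sum.inr (ι 2)) = a 2 <;> simp [h1, h2, h3]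

end Separation

/-! ### Accepted triples have a common parent -/

section Triples

variable {k m : ℕ} {M : Model k m}

theorem Model.IsPureChild.eq {a b : Fin k} {i : Fin m} (ha : M.IsPureChild a i)
    (hb : M.IsPureChild b i) : a = b := by
  simpa using hb.2.1 _ ha.1

/-- Every latent variable has a child outside two given ones. -/
theorem Model.IsLSM.exists_child (h : M.IsLSM) (l : Fin k) (i j : Fin m) :
    ∃ s, M.IsPureChild l s ∧ s ≠ i ∧ s ≠ j := by
  obtain ⟨S, hS, hc⟩ := h.three_children l
  have : ¬ S ⊆ {i, j} := fun hsub => by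
    have := (Finset.card_le_card hsub).trans Finset.card_le_two
    omega
  obtain ⟨s, hs, hsn⟩ := Finset.not_subset.1 this
  simp only [Finset.mem_insert, Finset.mem_singleton, not_or] at hsn
  exact ⟨s, hc s hs, hsn⟩

/-- Two children of one latent variable and one of another do not pass the test. -/
theorem Model.not_splits_of_pair (hLSM : M.IsLSM) {r : ℕ} (hr : ∀ l, M.card (Sum.inl l) = r)
    (hM : CausalMarkov M.graph M.prob) (hFa : Faithful M.graph M.prob)
    (hF : ∀ i : Fin m, FullColumnRank M.graph M.prob (Sum.inr i)) {a b : Fin k} (hab : a ≠ b)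
    {i j s : Fin m} (hi : M.IsPureChild a i) (hj : M.IsPureChild a j) (hs : M.IsPureChild b s)
    (hij : i ≠ j) :
    ∃ t, t ≠ i ∧ t ≠ j ∧ t ≠ s ∧ ¬ M.Splits r i j s t := by
  -- With a second child `t` of `b`, the vertex `b` itself is a common ancestor whose paths avoid
  -- `a`.
  obtain ⟨t, ht, hts, -⟩ := hLSM.exists_child b s s
  have hne : ∀ {x y : Fin m}, M.IsPureChild a x → M.IsPureChild b y → x ≠ y := by
    rintro x y hx hy rfl
    exact hab (hx.eq hy)
  refine ⟨t, (hne hi ht).symm, (hne hj ht).symm, hts, fun h => ?_⟩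
  have hc := h.condIndep (hr a) hM hF hi hj hij (hne hi hs) (hne hi ht) (hne hj hs) (hne hj ht)
  exact M.no_avoiding_ancestor hFa hts.symm hs ht hc (Sum.inl b) (by simpa using hab.symm)
    .refl .refl

/-- A triple of observed variables with a 3-way tensor of rank `r`, all of whose 4-way
extensions have rank `r`, has a common parent. -/
theorem Model.exists_parent_of_test (hLSM : M.IsLSM) {r : ℕ}
    (hr : ∀ l, M.card (Sum.inl l) = r)
    (hM : CausalMarkov M.graph M.prob) (hFa : Faithful M.graph M.prob)
    (hF : ∀ i : Fin m, FullColumnRank M.graph M.prob (Sum.inr i)) {i j s : Fin m}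
    (hij : i ≠ j) (his : i ≠ s) (hjs : j ≠ s)
    (h3 : tensorRank (tensor M.obsLaw ![i, j, s]) = r)
    (h4 : ∀ t, t ≠ i → t ≠ j → t ≠ s → tensorRank (tensor M.obsLaw ![i, j, s, t]) = r) :
    ∃ l, M.IsPureChild l i ∧ M.IsPureChild l j ∧ M.IsPureChild l s := by
  obtain ⟨a, hi⟩ := hLSM.pure i
  obtain ⟨b, hj⟩ := hLSM.pure j
  obtain ⟨c, hs⟩ := hLSM.pure s
  have hr2 : 2 ≤ r := hr a ▸ M.two_le_card (Sum.inl a)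
  have hsp : ∀ t, t ≠ i → t ≠ j → t ≠ s → M.Splits r i j s t := fun t h1 h2 h3 =>
    Model.splits_of_hasRankLE (hasRankLE_of_tensorRank_eq (h4 t h1 h2 h3) (by omega))
  by_cases hab : a = b
  · subst hab
    by_cases hac : a = c
    · subst hac
      exact ⟨a, hi, hj, hs⟩
    · obtain ⟨t, h1, h2, h3, hn⟩ := M.not_splits_of_pair hLSM hr hM hFa hF hac hi hj hs hij
      exact absurd (hsp t h1 h2 h3) hn
  · by_cases hac : a = c
    · subst hac
      obtain ⟨t, h1, h2, h3, hn⟩ := M.not_splits_of_pair hLSM hr hM hFa hF hab hi hs hj his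
      exact absurd (hsp t h1 h3 h2).swap_middle hn
    · by_cases hbc : b = c
      · subst hbc
        obtain ⟨t, h1, h2, h3, hn⟩ :=
          M.not_splits_of_pair hLSM hr hM hFa hF (Ne.symm hab) hj hs hi hjs
        exact absurd (hsp t h3 h1 h2).swap_first.swap_middle hn
      · exfalso
        have hne : ∀ {p q : Fin k} {x y : Fin m}, p ≠ q → M.IsPureChild p x →
            M.IsPureChild q y → x ≠ y := by
          rintro p q x y hpq hx hy rfl
          exact hpq (hx.eq hy)
        -- A second child of each parent, as fourth variable, supplies the pair of siblings needed
        -- to condition on that parent.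
        obtain ⟨t, ht, hti, -⟩ := hLSM.exists_child a i i
        obtain ⟨u, hu, huj, -⟩ := hLSM.exists_child b j j
        obtain ⟨w, hw, hws, -⟩ := hLSM.exists_child c s s
        have htj := hne hab ht hj
        have hts := hne hac ht hs
        have hui := hne (Ne.symm hab) hu hi
        have hus := hne hbc hu hs
        have hwi := hne (Ne.symm hac) hw hi
        have hwj := hne (Ne.symm hbc) hw hj
        have ca := (hsp t hti htj hts).swap_last.swap_middle.condIndep (hr a) hM hF hi ht
          hti.symm hij his htj hts
        have cb := (hsp u hui huj hus).swap_first.swap_last.swap_middle.condIndep (hr b) hM hF hj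
          hu huj.symm hij.symm hjs hui hus
        have cc := (hsp w hwi hwj hws).swap_middle.swap_first.swap_last.swap_middle.condIndep
          (hr c) hM hF hs hw hws.symm his.symm hjs.symm hwi hwj
        have na := M.no_avoiding_ancestor hFa hjs hj hs ca
        have nb := M.no_avoiding_ancestor hFa his hi hs cb
        have nc := M.no_avoiding_ancestor hFa hij hi hj cc
        have sym : ∀ {p x y : Fin k ⊕ Fin m},
            (∀ z, z ≠ p → ReachAvoiding M.graph p z x → ReachAvoiding M.graph p z y → False) →
            (∀ z, z ≠ p → ReachAvoiding M.graph p z y → ReachAvoiding M.graph p z x → False) :=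
          fun h z hz h1 h2 => h z hz h2 h1
        have inl_ne : ∀ {p q : Fin k}, p ≠ q → (Sum.inl p : Fin k ⊕ Fin m) ≠ Sum.inl q :=
          fun h h' => h (Sum.inl_injective h')
        have kab := hi.no_common_ancestor hij hj (not_common_ancestor M.acyclic
          (inl_ne (Ne.symm hbc)) (inl_ne (Ne.symm hac)) na nb nc)
        have kac := hi.no_common_ancestor his hs (not_common_ancestor M.acyclic
          (inl_ne hbc) (inl_ne (Ne.symm hab)) (sym na) nc nb)
        have kbc := hj.no_common_ancestor hjs hs (not_common_ancestor M.acyclic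
          (inl_ne hac) (inl_ne hab) (sym nb) (sym nc) na)
        -- Without common ancestors the 3-way rank is at most 1, against `2 ≤ r`; only here is the
        -- value of the 3-way rank used.
        have hone : HasRankLE (tensor M.obsLaw ![i, j, s]) 1 := by
          refine Model.hasRankLE_one hM fun t t' htt z => ?_
          fin_cases t <;> fin_cases t'
          · exact absurd rfl htt
          · exact kab z
          · exact kac z
          · exact fun h1 h2 => kab z h2 h1
          · exact absurd rfl htt
          · exact kbc z
          · exact fun h1 h2 => kac z h2 h1
          · exact fun h1 h2 => kbc z h2 h1
          · exact absurd rfl htt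
        have := tensorRank_le hone
        omega

end Triples

/-! ### The search loop -/

section Search

variable {m : ℕ} {d : Fin m → ℕ}

/-- The triples that the algorithm records. -/
def Accepted (p : Config d → ℝ) (r : ℕ) (t : Fin m × Fin m × Fin m) : Prop :=
  tensorRank (tensor p ![t.1, t.2.1, t.2.2]) = r ∧
    ∀ s, s ∉ ({t.1, t.2.1, t.2.2} : Finset (Fin m)) →
      tensorRank (tensor p ![t.1, t.2.1, t.2.2, s]) = r

theorem mem_testTriple (p : Config d → ℝ) (r : ℕ) (𝒞 : Finset (Finset (Fin m)))
    (t : Fin m × Fin m × Fin m) (A : Finset (Fin m)) :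
    A ∈ testTriple p r 𝒞 t ↔ A ∈ 𝒞 ∨ (Accepted p r t ∧ A = {t.1, t.2.1, t.2.2}) := by
  obtain ⟨i, j, k⟩ := t
  simp only [testTriple, Accepted]
  split_ifs with h1 h2
  · exact ⟨Or.inl, fun h => h.resolve_right fun h' => h1 h'.1.1⟩
  · rw [Finset.mem_insert, or_comm]
    exact or_congr_right ⟨fun h => ⟨⟨not_not.1 h1, h2⟩, h⟩, fun h => h.2⟩
  · exact ⟨Or.inl, fun h => h.resolve_right fun h' => h2 h'.1.2⟩

theorem mem_pass (p : Config d → ℝ) (r : ℕ) (𝒞 : Finset (Finset (Fin m)))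
    (A : Finset (Fin m)) :
    A ∈ pass p r 𝒞 ↔ A ∈ 𝒞 ∨ ∃ t ∈ triples m, Accepted p r t ∧ A = {t.1, t.2.1, t.2.2} := by
  unfold pass
  induction triples m generalizing 𝒞 with
  | nil => simp
  | cons t ts ih =>
    rw [List.foldl_cons, ih, mem_testTriple, or_assoc]
    simp

/-- The test of a triple ignores the clusters already found, so `pass` is idempotent and the search
is complete after one pass. -/
theorem mem_search (p : Config d → ℝ) (r : ℕ) (A : Finset (Fin m)) :
    A ∈ search p r ∅ ↔ ∃ t ∈ triples m, Accepted p r t ∧ A = {t.1, t.2.1, t.2.2} := by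
  have h2 : pass p r (pass p r ∅) = pass p r ∅ := by
    ext B
    rw [mem_pass, mem_pass, or_assoc, or_self]
  have h : search p r ∅ = pass p r ∅ := by
    rw [search]
    split_ifs with h1
    · exact h1.symm
    · rw [search, if_pos h2]
  rw [h, mem_pass]
  simp

theorem mem_triples (t : Fin m × Fin m × Fin m) :
    t ∈ triples m ↔ t.1 ≠ t.2.1 ∧ t.1 ≠ t.2.2 ∧ t.2.1 ≠ t.2.2 := by
  obtain ⟨i, j, k⟩ := t
  simp [triples, List.pair_mem_product]

end Search

/-! ### Merging overlapping clusters -/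

section Merge

variable {m : ℕ}

theorem MergeStep.card_lt {𝒞 𝒟 : Finset (Finset (Fin m))} (h : MergeStep 𝒞 𝒟) :
    𝒟.card < 𝒞.card := by
  obtain ⟨A, hA, B, hB, hAB, -, rfl⟩ := h
  have h1 := Finset.card_insert_le (A ∪ B) ((𝒞.erase A).erase B)
  have h2 := Finset.card_erase_of_mem (Finset.mem_erase.2 ⟨hAB.symm, hB⟩)
  have h3 := Finset.card_erase_of_mem hA
  have h4 : 1 < 𝒞.card := Finset.one_lt_card.2 ⟨A, hA, B, hB, hAB⟩
  omega

theorem acc_mergeStep (𝒞 : Finset (Finset (Fin m))) :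
    Acc (fun 𝒟 𝒞 : Finset (Finset (Fin m)) => MergeStep 𝒞 𝒟) 𝒞 :=
  Subrelation.accessible (r := fun 𝒟 𝒞 : Finset (Finset (Fin m)) => 𝒟.card < 𝒞.card)
    (fun h => MergeStep.card_lt h) ((measure Finset.card).wf.apply 𝒞)

theorem exists_terminal_merge (𝒞 : Finset (Finset (Fin m))) :
    ∃ 𝒟, Relation.ReflTransGen MergeStep 𝒞 𝒟 ∧ ∀ ℰ, ¬ MergeStep 𝒟 ℰ := by
  induction acc_mergeStep 𝒞 with
  | intro 𝒞 _ ih =>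
    by_cases h : ∃ 𝒟, MergeStep 𝒞 𝒟
    · obtain ⟨𝒟, h⟩ := h
      obtain ⟨ℰ, h1, h2⟩ := ih 𝒟 h
      exact ⟨ℰ, h1.head h, h2⟩
    · exact ⟨𝒞, .refl, fun ℰ hℰ => h ⟨ℰ, hℰ⟩⟩

/-- Every member of `𝒞` is a nonempty part of a block of `K`, and any two elements of a block
lie in a common member of `𝒞`. -/
def Chains {κ : Type} (K : κ → Finset (Fin m)) (𝒞 : Finset (Finset (Fin m))) : Prop :=
  (∀ A ∈ 𝒞, A.Nonempty ∧ ∃ l, A ⊆ K l) ∧ ∀ l, ∀ i ∈ K l, ∀ j ∈ K l, ∃ A ∈ 𝒞, i ∈ A ∧ j ∈ A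

variable {κ : Type} {K : κ → Finset (Fin m)} {𝒞 𝒟 : Finset (Finset (Fin m))}

theorem Chains.step (hK : ∀ l l' i, i ∈ K l → i ∈ K l' → l = l') (h : Chains K 𝒞)
    (hs : MergeStep 𝒞 𝒟) : Chains K 𝒟 := by
  obtain ⟨A, hA, B, hB, hAB, ⟨x, hx⟩, rfl⟩ := hs
  rw [Finset.mem_inter] at hx
  constructor
  · intro C hC
    rcases Finset.mem_insert.1 hC with rfl | hC
    · refine ⟨⟨x, Finset.mem_union_left _ hx.1⟩, ?_⟩
      obtain ⟨l, hl⟩ := (h.1 A hA).2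
      obtain ⟨l', hl'⟩ := (h.1 B hB).2
      -- Overlapping members lie in the same block because the blocks are disjoint.
      obtain rfl := hK l l' x (hl hx.1) (hl' hx.2)
      exact ⟨l, Finset.union_subset hl hl'⟩
    · exact h.1 C (Finset.mem_of_mem_erase (Finset.mem_of_mem_erase hC))
  · intro l i hi j hj
    obtain ⟨C, hC, hiC, hjC⟩ := h.2 l i hi j hj
    by_cases h1 : C = A
    · subst h1
      exact ⟨_, Finset.mem_insert_self _ _, Finset.mem_union_left _ hiC,
        Finset.mem_union_left _ hjC⟩
    · by_cases h2 : C = B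
      · subst h2
        exact ⟨_, Finset.mem_insert_self _ _, Finset.mem_union_right _ hiC,
          Finset.mem_union_right _ hjC⟩
      · exact ⟨C, Finset.mem_insert_of_mem (Finset.mem_erase.2 ⟨h2, Finset.mem_erase.2 ⟨h1, hC⟩⟩),
          hiC, hjC⟩

/-- Fix `i` in a member `A`. Each `j` of its block shares a member `B` with `i`; `A` and `B` overlap
at `i`, so they are equal when no merge is possible, and `A` is the whole block. -/
theorem Chains.mem_iff_of_terminal (hK : ∀ l l' i, i ∈ K l → i ∈ K l' → l = l')
    (hne : ∀ l, (K l).Nonempty) (h : Chains K 𝒞) (ht : ∀ 𝒟, ¬ MergeStep 𝒞 𝒟)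
    (A : Finset (Fin m)) : A ∈ 𝒞 ↔ ∃ l, A = K l := by
  have full : ∀ A ∈ 𝒞, ∀ l, A ⊆ K l → A = K l := by
    intro A hA l hl
    refine Finset.Subset.antisymm hl fun j hj => ?_
    obtain ⟨i, hi⟩ := (h.1 A hA).1
    obtain ⟨B, hB, hiB, hjB⟩ := h.2 l i (hl hi) j hj
    have : A = B := by
      by_contra hAB
      exact ht _ ⟨A, hA, B, hB, hAB, ⟨i, Finset.mem_inter.2 ⟨hi, hiB⟩⟩, rfl⟩
    exact this ▸ hjB
  constructor
  · intro hA
    obtain ⟨l, hl⟩ := (h.1 A hA).2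
    exact ⟨l, full A hA l hl⟩
  · rintro ⟨l, rfl⟩
    obtain ⟨i, hi⟩ := hne l
    obtain ⟨B, hB, hiB, -⟩ := h.2 l i hi i hi
    obtain ⟨l', hl'⟩ := (h.1 B hB).2
    obtain rfl := hK l l' i hi (hl' hiB)
    exact full B hB l hl' ▸ hB

end Merge

/-! ### Recorded triples and sets of children -/

section Clusters

variable {k m : ℕ} {M : Model k m}

theorem Model.IsLSM.mem_children (h : M.IsLSM) {l : Fin k} {i : Fin m} :
    i ∈ M.children l ↔ M.IsPureChild l i := by
  simp only [Model.children, Finset.mem_filter, Finset.mem_univ, true_and]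
  refine ⟨fun hi => ?_, fun hi => hi.1⟩
  obtain ⟨l', hl'⟩ := h.pure i
  obtain rfl : l = l' := by simpa using hl'.2.1 _ hi
  exact hl'

/-- The recorded triples are the triples of siblings. -/
theorem Model.accepted_iff (hLSM : M.IsLSM) {r : ℕ} (hr : ∀ l, M.card (Sum.inl l) = r)
    (hM : CausalMarkov M.graph M.prob) (hFa : Faithful M.graph M.prob)
    (hF : ∀ i : Fin m, FullColumnRank M.graph M.prob (Sum.inr i)) {i j s : Fin m}
    (hij : i ≠ j) (his : i ≠ s) (hjs : j ≠ s) :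
    Accepted M.obsLaw r (i, j, s) ↔
      ∃ l, M.IsPureChild l i ∧ M.IsPureChild l j ∧ M.IsPureChild l s := by
  constructor
  · rintro ⟨h3, h4⟩
    refine M.exists_parent_of_test hLSM hr hM hFa hF hij his hjs h3 fun t hti htj hts => h4 t ?_
    simp [hti, htj, hts]
  · rintro ⟨l, hi, hj, hs⟩
    refine ⟨?_, fun t ht => ?_⟩
    · refine Model.tensorRank_siblings (N := 1) (hr l) hM hF ?_ 2 (by decide) (by decide) ?_
      · intro a b hab
        fin_cases a <;> fin_cases b <;> simp_all
      · intro a ha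
        fin_cases a
        · exact hi
        · exact hj
        · exact hs
    · simp only [Finset.mem_insert, Finset.mem_singleton, not_or] at ht
      -- The arbitrary fourth variable occupies the exceptional slot 3.
      refine Model.tensorRank_siblings (N := 2) (hr l) hM hF ?_ 3 (by decide) (by decide) ?_
      · intro a b hab
        fin_cases a <;> fin_cases b <;> simp_all
      · intro a ha
        fin_cases a
        · exact hi
        · exact hj
        · exact hs
        · exact absurd rfl ha

/-- Two siblings are completed to a recorded triple by a third, which exists because each latent
variable has at least three children. -/
theorem Model.chains_search (hLSM : M.IsLSM) {r : ℕ} (hr : ∀ l, M.card (Sum.inl l) = r)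
    (hM : CausalMarkov M.graph M.prob) (hFa : Faithful M.graph M.prob)
    (hF : ∀ i : Fin m, FullColumnRank M.graph M.prob (Sum.inr i)) :
    Chains M.children (search M.obsLaw r ∅) := by
  constructor
  · intro A hA
    obtain ⟨⟨i, j, s⟩, ht, hacc, rfl⟩ := (mem_search _ _ _).1 hA
    obtain ⟨hij, his, hjs⟩ := (mem_triples _).1 ht
    obtain ⟨l, hi, hj, hs⟩ := (M.accepted_iff hLSM hr hM hFa hF hij his hjs).1 hacc
    refine ⟨⟨i, Finset.mem_insert_self _ _⟩, l, ?_⟩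
    intro x hx
    simp only [Finset.mem_insert, Finset.mem_singleton] at hx
    rw [hLSM.mem_children]
    rcases hx with rfl | rfl | rfl <;> assumption
  · have key : ∀ l i j, M.IsPureChild l i → M.IsPureChild l j → i ≠ j →
        ∃ A ∈ search M.obsLaw r ∅, i ∈ A ∧ j ∈ A := by
      intro l i j hi hj hij
      obtain ⟨s, hs, hsi, hsj⟩ := hLSM.exists_child l i j
      refine ⟨{i, j, s}, (mem_search _ _ _).2 ⟨(i, j, s),
        (mem_triples _).2 ⟨hij, hsi.symm, hsj.symm⟩,
        (M.accepted_iff hLSM hr hM hFa hF hij hsi.symm hsj.symm).2 ⟨l, hi, hj, hs⟩, rfl⟩, ?_, ?_⟩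
      <;> simp
    intro l i hi j hj
    rw [hLSM.mem_children] at hi hj
    by_cases hij : i = j
    · subst hij
      obtain ⟨s, hs, hsi, -⟩ := hLSM.exists_child l i i
      obtain ⟨A, hA, h, -⟩ := key l i s hi hs hsi.symm
      exact ⟨A, hA, h, h⟩
    · exact key l i j hi hj hij

end Clusters

end DiscreteLSM

theorem theorem2 {k m : ℕ} (M : DiscreteLSM.Model k m) (r : ℕ)
    (hLSM : M.IsLSM)
    (hr : ∀ l : Fin k, M.card (Sum.inl l) = r)
    (hMarkov : DiscreteLSM.CausalMarkov M.graph M.prob)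
    (hFaithful : DiscreteLSM.Faithful M.graph M.prob)
    (hFullRank : ∀ i : Fin m, DiscreteLSM.FullColumnRank M.graph M.prob (Sum.inr i)) :
    -- the merging phase terminates, in whatever order the merges are made
    Acc (fun 𝒟 𝒞 => DiscreteLSM.MergeStep 𝒞 𝒟) (DiscreteLSM.search M.obsLaw r ∅) ∧
    ∃ 𝒞 : Finset (Finset (Fin m)),
      -- all runs return the same family of clusters
      (∀ 𝒟, DiscreteLSM.Outputs M.obsLaw r 𝒟 ↔ 𝒟 = 𝒞) ∧
      -- the clusters are the sets of children of the latent variables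
      (∀ A, A ∈ 𝒞 ↔ ∃ l, A = M.children l) ∧
      -- the returned graph is the measurement model, up to the names of the latent variables
      ∃ σ : {A // A ∈ 𝒞} ≃ Fin k, ∀ u v,
        (DiscreteLSM.outputGraph 𝒞).Adj u v ↔
          M.measurementModel.Adj (Sum.map σ id u) (Sum.map σ id v) := by
  classical
  refine ⟨DiscreteLSM.acc_mergeStep _, ?_⟩
  have hK : ∀ l l' i, i ∈ M.children l → i ∈ M.children l' → l = l' := fun l l' i h h' =>
    (hLSM.mem_children.1 h).eq (hLSM.mem_children.1 h')
  have hne : ∀ l, (M.children l).Nonempty := by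
    intro l
    obtain ⟨S, hS, hc⟩ := hLSM.three_children l
    obtain ⟨i, hi⟩ := Finset.card_pos.1 (by omega : 0 < S.card)
    exact ⟨i, hLSM.mem_children.2 (hc i hi)⟩
  have hchains : ∀ 𝒟, Relation.ReflTransGen DiscreteLSM.MergeStep
      (DiscreteLSM.search M.obsLaw r ∅) 𝒟 → DiscreteLSM.Chains M.children 𝒟 := by
    intro 𝒟 h
    induction h with
    | refl => exact M.chains_search hLSM hr hMarkov hFaithful hFullRank
    | tail _ hs ih => exact ih.step hK hs
  have hmem : ∀ 𝒟, DiscreteLSM.Outputs M.obsLaw r 𝒟 →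
      ∀ A, A ∈ 𝒟 ↔ ∃ l, A = M.children l := fun 𝒟 h =>
    (hchains 𝒟 h.1).mem_iff_of_terminal hK hne h.2
  obtain ⟨𝒞, h𝒞⟩ := DiscreteLSM.exists_terminal_merge (DiscreteLSM.search M.obsLaw r ∅)
  have h𝒞mem := hmem 𝒞 h𝒞
  refine ⟨𝒞, fun 𝒟 => ⟨fun h => ?_, fun h => h ▸ h𝒞⟩, h𝒞mem, ?_⟩
  · ext A
    rw [hmem 𝒟 h, h𝒞mem]
  · let τ : Fin k → {A // A ∈ 𝒞} := fun l => ⟨M.children l, (h𝒞mem _).2 ⟨l, rfl⟩⟩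
    -- Injective because sets of children are nonempty and disjoint; surjective because every
    -- cluster is such a set.
    have hτ : Function.Bijective τ := by
      constructor
      · intro l l' h
        obtain ⟨i, hi⟩ := hne l
        have e : M.children l = M.children l' := congrArg Subtype.val h
        exact hK l l' i hi (e ▸ hi)
      · rintro ⟨A, hA⟩
        obtain ⟨l, rfl⟩ := (h𝒞mem A).1 hA
        exact ⟨l, rfl⟩
    refine ⟨(Equiv.ofBijective τ hτ).symm, ?_⟩
    rintro (A | i) (B | j)
    · simp [DiscreteLSM.outputGraph, DiscreteLSM.Model.measurementModel]
    · obtain ⟨l, rfl⟩ := hτ.2 A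
      simp [DiscreteLSM.outputGraph, DiscreteLSM.Model.measurementModel, τ,
        DiscreteLSM.Model.children]
    · simp [DiscreteLSM.outputGraph, DiscreteLSM.Model.measurementModel]
    · simp [DiscreteLSM.outputGraph, DiscreteLSM.Model.measurementModel]
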